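/- Let $T>0$, let $(\Omega,\mathcal F,(\mathcal F_t)_{t\in[0,T]},\mathbb P)$ be a filtered probability space, and let $\mathcal L^2$ be the Hilbert space of (classes of) progressively measurable $u:[0,T]\times\Omega\to\mathbb R$ with $\mathbb E\int_0^T u_t^2\,dt<\infty$, with inner product $\langle f,g\rangle=\mathbb E\int_0^T f_tg_t\,dt$; adjoints $^*$ are taken in $\mathcal L^2$ and $\mathbf I$ is the identity. Let $G:\mathbb R\to\mathbb R$ be measurable and square integrable on $[0,T]$, let $\kappa_\infty,\gamma,\phi,\varrho,X_0\in\mathbb R$, and let $\mathbf G,\mathbf H,\mathbf H_{\phi,\varrho}$ be the bounded operators on $\mathcal L^2$ $$(\mathbf Gu)_t=\int_0^tG(t-s)u_s\,ds,\qquad (\mathbf Hu)_t=\kappa_\infty\int_0^tu_s\,ds,\qquad(\mathbf H_{\phi,\varrho}u)_t=\int_0^t\big(\phi(T-t)+\varrho\big)u_s\,ds .$$ Let $\mathcal U:\mathbb R\to\mathbb R$ be differentiable and Lipschitz continuous. Let $S=P+M$, where $P$ is progressively measurable with $\mathbb E\int_0^TP_t^2\,dt<\infty$ and $\mathbb E[P_T^2]<\infty$,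 and $M$ is a progressively measurable square-integrable martingale. For $u\in\mathcal L^2$ put $X^u_t=X_0+\int_0^tu_s\,ds$, $S^u=S+\frac\gamma2u+(\mathbf H+\mathbf G)(u-r^u)$, where $r^u\in\mathcal L^2$ solves $r^u=\mathcal U(\mathbf G(u-r^u))$ ($dt\otimes\mathbb P$-a.e.), and $$\mathcal J(u)=\mathbb E\Big[-\int_0^TS^u_tu_t\,dt+X^u_TS_T-\frac\phi2\int_0^T(X^u_t)^2\,dt-\frac\varrho2(X^u_T)^2\Big].$$ Let $\mathbf M^u$ be the multiplication operator $(\mathbf M^uv)_t=\mathcal U'\big(\mathbf G(u-r^u)_t\big)v_t$ on $\mathcal L^2$. Then: 1. For every $u\in\mathcal L^2$ the equation $r^u=\mathcal U(\mathbf G(u-r^u))$ has exactly one solution $r^u=:\mathbf R(u)$ in $\mathcal L^2$, and the random variable under the expectation defining $\mathcal J(u)$ is integrable. 2. There is $\alpha\in\mathcal L^2$ such that $\alpha_t=\mathbb E[S_T-S_t\mid\mathcal F_t]$ a.s. for a.e. $t\in[0,T]$. 3. For all $u\in\mathcal L^2$ the bounded operators $\mathbf I+\mathbf M^u\mathbf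 G$ and $\mathbf I+(\mathbf M^u\mathbf G)^*$ are invertible with bounded inverse, and $D\mathbf R(u):=\mathbf I-(\mathbf I+\mathbf M^u\mathbf G)^{-1}$ gives the directional derivatives of $\mathbf R$ at $u$: $\lim_{\varepsilon\to0}\varepsilon^{-1}\big(\mathbf R(u+\varepsilon h)-\mathbf R(u)\big)=D\mathbf R(u)h$ in $\mathcal L^2$ for every $h\in\mathcal L^2$. 4. $\mathcal J$ is Fréchet differentiable on $\mathcal L^2$, with gradient at $u$ $$\nabla\mathcal J(u)=\alpha-X_0\big(\phi(T-\cdot)+\varrho\big)-\gamma u-(\mathbf H+\mathbf G)(u-\mathbf R(u))-\big((\mathbf H+\mathbf G)(\mathbf I-D\mathbf R(u))\big)^*u-(\mathbf H_{\phi,\varrho}+\mathbf H_{\phi,\varrho}^*)u .$$ 5. Every local extremum (local minimizer or local maximizer) $u\in\mathcal L^2$ of $\mathcal J$ satisfies $\nabla\mathcal J(u)=0$; in other words, it satisfies the nonlinear stochastic Fredholm system $$\gamma u+(\mathbf H+\mathbf G)u+(\mathbf H_{\phi,\varrho}+\mathbf H_{\phi,\varrho}^*)u-\mathbf A(u)=\alpha-X_0\big(\phi(T-\cdot)+\varrho\big),\qquad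 r^u=\mathbf R(u),$$ where $$\mathbf A(u)=(\mathbf H+\mathbf G)\mathbf R(u)-\big(\mathbf I+(\mathbf M^u\mathbf G)^*\big)^{-1}(\mathbf H+\mathbf G)^*u .$$ -/

import Mathlib

open MeasureTheory ProbabilityTheory Set Filter Topology
open scoped NNReal ENNReal InnerProduct

noncomputable section

namespace MarketResistance

/-- The time interval `[0, T]`. -/
abbrev Time (T : ℝ) : Type := Icc (0 : ℝ) T

/-- Lebesgue measure on `[0, T]`. -/
def dt (T : ℝ) : Measure (Time T) := Measure.comap Subtype.val volume

instance (T : ℝ) : IsFiniteMeasure (dt T) := by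
  constructor
  rw [dt, Measure.comap_apply _ Subtype.val_injective
    (fun s hs => (MeasurableEmbedding.subtype_coe measurableSet_Icc).measurableSet_image.2 hs) _
    MeasurableSet.univ]
  rw [image_univ, Subtype.range_coe]
  exact measure_Icc_lt_top

section Space

variable {Ω : Type*} [mΩ : MeasurableSpace Ω] {T : ℝ}

lemma measurable_uncurry_of_isProgressive {𝓕 : Filtration (Time T) mΩ} {g : Time T → Ω → ℝ}
    (hg : IsProgressive 𝓕 g) : Measurable (Function.uncurry g) := by
  rcases isEmpty_or_nonempty (Time T) with h | ⟨⟨t, ht⟩⟩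
  · exact measurable_of_empty _
  · have hT : (0 : ℝ) ≤ T := ht.1.trans ht.2
    have h1 := (hg ⟨T, hT, le_rfl⟩).mono
      (sup_le_sup le_rfl (MeasurableSpace.comap_mono (𝓕.le _))) le_rfl
    have h2 : Measurable (fun p : Time T × Ω =>
        ((⟨p.1, p.1.2.2⟩ : Iic (⟨T, hT, le_rfl⟩ : Time T)), p.2)) := by
      fun_prop
    exact h1.comp h2

/-- The progressive `σ`-algebra on `[0, T] × Ω`. -/
abbrev progSigma (𝓕 : Filtration (Time T) mΩ) : MeasurableSpace (Time T × Ω) :=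
  ⨅ i, MeasurableSpace.map (fun p : Iic i × Ω => ((p.1 : Time T), p.2))
    (MeasurableSpace.prod Subtype.instMeasurableSpace (𝓕 i))

lemma measurable_progSigma_iff (𝓕 : Filtration (Time T) mΩ) (g : Time T → Ω → ℝ) :
    Measurable[progSigma 𝓕] (Function.uncurry g) ↔ IsProgressive 𝓕 g := by
  constructor
  · intro h i s hs
    have := h hs
    rw [progSigma, MeasurableSpace.measurableSet_iInf] at this
    exact this i
  · intro h s hs
    rw [progSigma, MeasurableSpace.measurableSet_iInf]
    intro i
    exact h i hs

lemma progSigma_le (𝓕 : Filtration (Time T) mΩ) :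
    progSigma 𝓕 ≤ (inferInstance : MeasurableSpace (Time T × Ω)) := by
  intro s hs
  have h : IsProgressive 𝓕 (Function.curry (s.indicator fun _ => (1 : ℝ))) :=
    (measurable_progSigma_iff 𝓕 _).1
      (Measurable.indicator (m := progSigma 𝓕) (f := fun _ => (1 : ℝ)) measurable_const hs)
  have h2 := measurable_uncurry_of_isProgressive h (measurableSet_singleton (1 : ℝ))
  convert h2 using 1
  ext p
  simp

/-- The Hilbert space of (classes of) progressively measurable processes `u` on `[0, T] × Ω` with
`E[∫₀ᵀ uₜ² dt] < ∞`, as a subspace of `L²([0, T] × Ω)`. -/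
def ProcL2 (𝓕 : Filtration (Time T) mΩ) (μ : Measure Ω) :
    Submodule ℝ (Lp ℝ 2 ((dt T).prod μ)) where
  carrier := {f | ∃ g : Time T → Ω → ℝ, IsProgressive 𝓕 g ∧
    (f : Time T × Ω → ℝ) =ᵐ[(dt T).prod μ] Function.uncurry g}
  zero_mem' := ⟨fun _ _ => 0, isProgressive_const _ _, Lp.coeFn_zero _ _ _⟩
  add_mem' := by
    rintro f₁ f₂ ⟨g₁, h₁, e₁⟩ ⟨g₂, h₂, e₂⟩
    exact ⟨fun t ω => g₁ t ω + g₂ t ω, h₁.add h₂, (Lp.coeFn_add f₁ f₂).trans (e₁.add e₂)⟩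
  smul_mem' := by
    rintro c f ⟨g, h, e⟩
    exact ⟨fun t ω => c * g t ω, fun i => (h i).const_mul c,
      (Lp.coeFn_smul c f).trans (e.fun_comp fun x => c * x)⟩

lemma procL2_eq_lpMeas (𝓕 : Filtration (Time T) mΩ) (μ : Measure Ω) :
    ProcL2 𝓕 μ = lpMeas ℝ ℝ (progSigma 𝓕) 2 ((dt T).prod μ) := by
  ext f
  rw [mem_lpMeas_iff_aestronglyMeasurable]
  constructor
  · rintro ⟨g, hg, e⟩
    exact ⟨Function.uncurry g,
      ((measurable_progSigma_iff 𝓕 g).2 hg).stronglyMeasurable, e⟩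
  · rintro ⟨g, hg, e⟩
    exact ⟨Function.curry g, (measurable_progSigma_iff 𝓕 _).1 hg.measurable, e⟩

instance (𝓕 : Filtration (Time T) mΩ) (μ : Measure Ω) : CompleteSpace (ProcL2 𝓕 μ) := by
  rw [procL2_eq_lpMeas]
  have : Fact (progSigma 𝓕 ≤ (inferInstance : MeasurableSpace (Time T × Ω))) := ⟨progSigma_le 𝓕⟩
  infer_instance

variable {𝓕 : Filtration (Time T) mΩ} {μ : Measure Ω}

instance : CoeFun (ProcL2 𝓕 μ) (fun _ => Time T × Ω → ℝ) := ⟨fun u => ((u : Lp ℝ 2 ((dt T).prod μ)) : Time T × Ω → ℝ)⟩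

/-- The element of `ProcL2` given by a square integrable function on `[0, T] × Ω` that has a
progressively measurable version. -/
def ofProcess (f : Time T × Ω → ℝ) (hf : MemLp f 2 ((dt T).prod μ))
    (hp : ∃ g : Time T → Ω → ℝ, IsProgressive 𝓕 g ∧ f =ᵐ[(dt T).prod μ] Function.uncurry g) :
    ProcL2 𝓕 μ :=
  ⟨hf.toLp f, by
    obtain ⟨g, hg, e⟩ := hp
    exact ⟨g, hg, hf.coeFn_toLp.trans e⟩⟩

lemma coeFn_ofProcess (f : Time T × Ω → ℝ) (hf hp) :
    (ofProcess (𝓕 := 𝓕) (μ := μ) f hf hp : Time T × Ω → ℝ) =ᵐ[(dt T).prod μ] f :=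
  hf.coeFn_toLp

end Space

section Volterra

variable {Ω : Type*} [mΩ : MeasurableSpace Ω] {T : ℝ}

/-- An admissible Volterra kernel: `sup_{t ≤ T} ∫₀ᵗ |K(t, s)|² ds < ∞`. Only the values `K t s`
with `s ≤ t` matter. -/
structure IsAdmissible (K : Time T → Time T → ℝ) : Prop where
  measurable : Measurable (Function.uncurry K)
  bound : ∃ C : ℝ≥0, ∀ t, ∫⁻ s in Iic t, ‖K t s‖ₑ ^ 2 ∂(dt T) ≤ C

/-- `(t, ω) ↦ ∫₀ᵗ K(t, s) f(s, ω) ds`. -/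
def volterraFun (K : Time T → Time T → ℝ) (f : Time T × Ω → ℝ) : Time T × Ω → ℝ :=
  fun p => ∫ s in Iic p.1, K p.1 s * f (s, p.2) ∂(dt T)

lemma ae_section {μ : Measure Ω} [SFinite μ] {P : Time T × Ω → Prop}
    (h : ∀ᵐ p ∂((dt T).prod μ), P p) :
    ∀ᵐ p ∂((dt T).prod μ), ∀ᵐ s ∂(dt T), P (s, p.2) := by
  have h1 := (Measure.measurePreserving_swap (μ := μ) (ν := dt T)).quasiMeasurePreserving.ae h
  exact (Measure.quasiMeasurePreserving_snd (μ := dt T) (ν := μ)).ae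
    (Measure.ae_ae_of_ae_prod h1)

lemma volterraFun_congr {μ : Measure Ω} [SFinite μ] (K : Time T → Time T → ℝ)
    {f g : Time T × Ω → ℝ} (h : f =ᵐ[(dt T).prod μ] g) :
    volterraFun K f =ᵐ[(dt T).prod μ] volterraFun K g := by
  filter_upwards [ae_section h] with p hp
  refine integral_congr_ae (ae_restrict_of_ae ?_)
  filter_upwards [hp] with s hs
  rw [hs]

lemma measurable_volterra_aux {Ω' : Type*} [MeasurableSpace Ω'] {K : Time T → Time T → ℝ}
    (hK : Measurable (Function.uncurry K)) (i : Time T) {g : Time T → Ω' → ℝ}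
    (hg : Measurable fun p : Iic i × Ω' => g p.1 p.2) :
    Measurable fun p : Iic i × Ω' => ∫ s in Iic (p.1 : Time T), K p.1 s * g s p.2 ∂(dt T) := by
  have e : (fun p : Iic i × Ω' => ∫ s in Iic (p.1 : Time T), K p.1 s * g s p.2 ∂(dt T)) =
      fun p : Iic i × Ω' => ∫ s, {q : (Iic i × Ω') × Time T | q.2 ≤ (q.1.1 : Time T)}.indicator
        (fun q => K q.1.1 q.2 *
          g ((⟨min q.2 i, mem_Iic.2 (min_le_right _ _)⟩ : Iic i) : Time T) q.1.2) (p, s) ∂(dt T) := by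
    funext p
    rw [← integral_indicator measurableSet_Iic]
    congr 1
    funext s
    by_cases hs : s ≤ (p.1 : Time T)
    · have : min s i = s := min_eq_left (hs.trans p.1.2)
      simp [indicator, hs, this]
    · simp [indicator, hs]
  rw [e]
  refine (StronglyMeasurable.integral_prod_right (ν := dt T) (f := fun p s =>
    {q : (Iic i × Ω') × Time T | q.2 ≤ (q.1.1 : Time T)}.indicator
        (fun q => K q.1.1 q.2 *
          g ((⟨min q.2 i, mem_Iic.2 (min_le_right _ _)⟩ : Iic i) : Time T) q.1.2) (p, s)) ?_).measurable
  refine Measurable.stronglyMeasurable ?_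
  refine Measurable.indicator ?_ ?_
  · refine Measurable.mul ?_ ?_
    · exact hK.comp (by fun_prop : Measurable fun q : (Iic i × Ω') × Time T =>
        ((q.1.1 : Time T), q.2))
    · exact hg.comp (by fun_prop : Measurable fun q : (Iic i × Ω') × Time T =>
        ((⟨min q.2 i, mem_Iic.2 (min_le_right _ _)⟩ : Iic i), q.1.2))
  · exact measurableSet_le measurable_snd (by fun_prop)

lemma isProgressive_volterra {𝓕 : Filtration (Time T) mΩ} {K : Time T → Time T → ℝ}
    (hK : Measurable (Function.uncurry K)) {g : Time T → Ω → ℝ} (hg : IsProgressive 𝓕 g) :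
    IsProgressive 𝓕 (Function.curry (volterraFun K (Function.uncurry g))) := fun i =>
  @measurable_volterra_aux T Ω (𝓕 i) K hK i g (hg i)

lemma enorm_volterraFun_sq_le {K : Time T → Time T → ℝ} (hK : Measurable (Function.uncurry K))
    {C : ℝ≥0} (hC : ∀ t, ∫⁻ s in Iic t, ‖K t s‖ₑ ^ 2 ∂(dt T) ≤ C)
    {f : Time T × Ω → ℝ} (hf : Measurable f) (p : Time T × Ω) :
    ‖volterraFun K f p‖ₑ ^ 2 ≤ C * ∫⁻ s, ‖f (s, p.2)‖ₑ ^ 2 ∂(dt T) := by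
  have hK' : Measurable fun s => ‖K p.1 s‖ₑ := (hK.comp (measurable_prodMk_left)).enorm
  have hf' : Measurable fun s => ‖f (s, p.2)‖ₑ := (hf.comp (measurable_prodMk_right)).enorm
  have h1 : ‖volterraFun K f p‖ₑ ≤
      ∫⁻ s in Iic p.1, ((fun s => ‖K p.1 s‖ₑ) * fun s => ‖f (s, p.2)‖ₑ) s ∂(dt T) := by
    refine (enorm_integral_le_lintegral_enorm _).trans_eq ?_
    simp [enorm_mul]
  have h2 := h1.trans (ENNReal.lintegral_mul_le_Lp_mul_Lq ((dt T).restrict (Iic p.1))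
    Real.HolderConjugate.two_two hK'.aemeasurable hf'.aemeasurable)
  have h3 : ∀ x : ℝ≥0∞, (x ^ (1 / 2 : ℝ)) ^ 2 = x := fun x => by
    rw [← ENNReal.rpow_natCast, ← ENNReal.rpow_mul]; norm_num
  calc ‖volterraFun K f p‖ₑ ^ 2 ≤
      ((∫⁻ s in Iic p.1, ‖K p.1 s‖ₑ ^ (2 : ℝ) ∂(dt T)) ^ (1 / 2 : ℝ) *
        (∫⁻ s in Iic p.1, ‖f (s, p.2)‖ₑ ^ (2 : ℝ) ∂(dt T)) ^ (1 / 2 : ℝ)) ^ 2 :=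
      pow_le_pow_left₀ zero_le h2 2
    _ = (∫⁻ s in Iic p.1, ‖K p.1 s‖ₑ ^ 2 ∂(dt T)) * ∫⁻ s in Iic p.1, ‖f (s, p.2)‖ₑ ^ 2 ∂(dt T) := by
      rw [mul_pow, h3, h3]; simp only [ENNReal.rpow_two]
    _ ≤ _ := by gcongr; exacts [hC _, Measure.restrict_le_self]

lemma eLpNorm_volterraFun_le {μ : Measure Ω} [SFinite μ] {K : Time T → Time T → ℝ}
    (hK : Measurable (Function.uncurry K))
    {C : ℝ≥0} (hC : ∀ t, ∫⁻ s in Iic t, ‖K t s‖ₑ ^ 2 ∂(dt T) ≤ C)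
    {f : Time T × Ω → ℝ} (hf : Measurable f) :
    eLpNorm (volterraFun K f) 2 ((dt T).prod μ) ≤
      (dt T univ * C) ^ (1 / 2 : ℝ) * eLpNorm f 2 ((dt T).prod μ) := by
  rw [eLpNorm_eq_lintegral_rpow_enorm_toReal (by norm_num) (by norm_num),
    eLpNorm_eq_lintegral_rpow_enorm_toReal (by norm_num) (by norm_num)]
  simp only [ENNReal.toReal_ofNat, ENNReal.rpow_two]
  rw [← ENNReal.mul_rpow_of_nonneg _ _ (by norm_num)]
  refine ENNReal.rpow_le_rpow ?_ (by norm_num)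
  have hm : Measurable fun p : Time T × Ω => ‖f p‖ₑ ^ 2 := hf.enorm.pow_const 2
  have hm2 : Measurable fun ω => ∫⁻ s, ‖f (s, ω)‖ₑ ^ 2 ∂(dt T) := hm.lintegral_prod_left
  calc _ ≤ ∫⁻ p, C * ∫⁻ s, ‖f (s, p.2)‖ₑ ^ 2 ∂(dt T) ∂((dt T).prod μ) :=
        lintegral_mono fun p => enorm_volterraFun_sq_le hK hC hf p
    _ = _ := by
      rw [lintegral_prod_symm' _ hm, lintegral_prod _ (by fun_prop)]
      simp only
      rw [lintegral_const, lintegral_const_mul _ hm2]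
      ring

lemma memLp_section {μ : Measure Ω} [SFinite μ] {f : Time T × Ω → ℝ}
    (hf : MemLp f 2 ((dt T).prod μ)) :
    ∀ᵐ p ∂((dt T).prod μ), MemLp (fun s => f (s, p.2)) 2 (dt T) := by
  have h1 : Integrable (fun q => f q.swap ^ 2) (μ.prod (dt T)) :=
    (Measure.measurePreserving_swap (μ := μ) (ν := dt T)).integrable_comp_of_integrable
      hf.integrable_sq
  have h2 : AEStronglyMeasurable (fun q => f q.swap) (μ.prod (dt T)) :=
    hf.1.comp_measurePreserving (Measure.measurePreserving_swap (μ := μ) (ν := dt T))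
  refine (Measure.quasiMeasurePreserving_snd (μ := dt T) (ν := μ)).ae
    (p := fun ω => MemLp (fun s => f (s, ω)) 2 (dt T)) ?_
  filter_upwards [h1.prod_right_ae, h2.prodMk_left] with ω h3 h4
  exact (memLp_two_iff_integrable_sq h4).2 h3

lemma IsAdmissible.memLp {K : Time T → Time T → ℝ} (hK : IsAdmissible K) (t : Time T) :
    MemLp (K t) 2 ((dt T).restrict (Iic t)) := by
  obtain ⟨C, hC⟩ := hK.bound
  refine ⟨(hK.measurable.comp measurable_prodMk_left).aestronglyMeasurable, ?_⟩
  rw [eLpNorm_eq_lintegral_rpow_enorm_toReal (by norm_num) (by norm_num)]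
  simp only [ENNReal.toReal_ofNat, ENNReal.rpow_two]
  exact ENNReal.rpow_lt_top_of_nonneg (by norm_num) ((hC t).trans_lt ENNReal.coe_lt_top).ne

lemma IsAdmissible.integrable {μ : Measure Ω} [SFinite μ] {K : Time T → Time T → ℝ}
    (hK : IsAdmissible K) {f : Time T × Ω → ℝ} (hf : MemLp f 2 ((dt T).prod μ)) :
    ∀ᵐ p ∂((dt T).prod μ),
      IntegrableOn (fun s => K p.1 s * f (s, p.2)) (Iic p.1) (dt T) := by
  filter_upwards [memLp_section hf] with p hp
  exact (hK.memLp p.1).integrable_mul (hp.mono_measure Measure.restrict_le_self)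

variable {𝓕 : Filtration (Time T) mΩ} {μ : Measure Ω} [SFinite μ]

lemma progressive_volterraFun {K : Time T → Time T → ℝ} (hK : IsAdmissible K) (u : ProcL2 𝓕 μ) :
    ∃ g : Time T → Ω → ℝ, IsProgressive 𝓕 g ∧
      volterraFun K u =ᵐ[(dt T).prod μ] Function.uncurry g := by
  obtain ⟨g, hg, e⟩ := u.2
  exact ⟨_, isProgressive_volterra hK.measurable hg, volterraFun_congr K e⟩

lemma eLpNorm_volterraFun_le' {K : Time T → Time T → ℝ} (hK : IsAdmissible K) (u : ProcL2 𝓕 μ) :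
    eLpNorm (volterraFun K u) 2 ((dt T).prod μ) ≤
      (dt T univ * hK.bound.choose) ^ (1 / 2 : ℝ) * eLpNorm u 2 ((dt T).prod μ) := by
  obtain ⟨g, hg, e⟩ := u.2
  rw [eLpNorm_congr_ae (volterraFun_congr K e), eLpNorm_congr_ae e]
  exact eLpNorm_volterraFun_le hK.measurable hK.bound.choose_spec
    (measurable_uncurry_of_isProgressive hg)

lemma memLp_volterraFun {K : Time T → Time T → ℝ} (hK : IsAdmissible K) (u : ProcL2 𝓕 μ) :
    MemLp (volterraFun K u) 2 ((dt T).prod μ) := by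
  refine ⟨?_, (eLpNorm_volterraFun_le' hK u).trans_lt ?_⟩
  · obtain ⟨g, hg, e⟩ := progressive_volterraFun hK u
    exact ⟨_, (measurable_uncurry_of_isProgressive hg).stronglyMeasurable, e⟩
  · refine ENNReal.mul_lt_top (ENNReal.rpow_lt_top_of_nonneg (by norm_num) ?_) (Lp.eLpNorm_lt_top _)
    exact ENNReal.mul_ne_top (measure_ne_top _ _) ENNReal.coe_ne_top

/-- The bounded operator `(K u)ₜ = ∫₀ᵗ K(t, s) uₛ ds` on `ProcL2` induced by an admissible
kernel. -/
def volterraOp (K : Time T → Time T → ℝ) (hK : IsAdmissible K) :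
    ProcL2 𝓕 μ →L[ℝ] ProcL2 𝓕 μ :=
  LinearMap.mkContinuous
    { toFun := fun u =>
        ofProcess (volterraFun K u) (memLp_volterraFun hK u) (progressive_volterraFun hK u)
      map_add' := fun u v => by
        apply Subtype.ext
        apply Lp.ext
        refine (coeFn_ofProcess _ _ _).trans (EventuallyEq.trans ?_ (Lp.coeFn_add _ _).symm)
        refine (volterraFun_congr K (Lp.coeFn_add _ _)).trans (EventuallyEq.trans ?_
          ((coeFn_ofProcess _ _ _).add (coeFn_ofProcess _ _ _)).symm)
        filter_upwards [hK.integrable (Lp.memLp (u : Lp ℝ 2 ((dt T).prod μ))),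
          hK.integrable (Lp.memLp (v : Lp ℝ 2 ((dt T).prod μ)))] with p h1 h2
        simp only [volterraFun, Pi.add_apply, mul_add]
        exact integral_add h1 h2
      map_smul' := fun c u => by
        apply Subtype.ext
        apply Lp.ext
        refine (coeFn_ofProcess _ _ _).trans (EventuallyEq.trans ?_ (Lp.coeFn_smul _ _).symm)
        refine (volterraFun_congr K (Lp.coeFn_smul _ _)).trans (EventuallyEq.trans ?_
          ((coeFn_ofProcess _ _ _).fun_comp fun x => c • x).symm)
        refine Eventually.of_forall fun p => ?_
        simp only [volterraFun, Pi.smul_apply, smul_eq_mul, Function.comp_apply,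
          mul_left_comm _ c]
        exact integral_const_mul c _ }
    ((dt T univ * hK.bound.choose) ^ (1 / 2 : ℝ)).toReal
    (fun u => by
      change ‖(memLp_volterraFun hK u).toLp _‖ ≤ _ * ‖(u : Lp ℝ 2 ((dt T).prod μ))‖
      rw [Lp.norm_toLp, Lp.norm_def, ← ENNReal.toReal_mul]
      refine ENNReal.toReal_mono ?_ (eLpNorm_volterraFun_le' hK u)
      refine ENNReal.mul_ne_top (ENNReal.rpow_ne_top_of_nonneg (by norm_num) ?_)
        (Lp.eLpNorm_ne_top _)
      exact ENNReal.mul_ne_top (measure_ne_top _ _) ENNReal.coe_ne_top)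

lemma coeFn_volterraOp (K : Time T → Time T → ℝ) (hK : IsAdmissible K) (u : ProcL2 𝓕 μ) :
    (volterraOp K hK u : Time T × Ω → ℝ) =ᵐ[(dt T).prod μ] volterraFun K u :=
  coeFn_ofProcess _ (memLp_volterraFun hK u) (progressive_volterraFun hK u)

end Volterra

section Kernels

variable {T : ℝ}

lemma isAdmissible_of_bounded {K : Time T → Time T → ℝ} (hK : Measurable (Function.uncurry K))
    (B : ℝ≥0) (hB : ∀ t s, ‖K t s‖₊ ≤ B) : IsAdmissible K := by
  refine ⟨hK, (B ^ 2 * (dt T univ).toNNReal), fun t => ?_⟩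
  calc ∫⁻ s in Iic t, ‖K t s‖ₑ ^ 2 ∂(dt T) ≤ ∫⁻ _ in Iic t, (B : ℝ≥0∞) ^ 2 ∂(dt T) := by
        refine lintegral_mono fun s => ?_
        gcongr
        exact ENNReal.coe_le_coe.2 (hB t s)
    _ ≤ ∫⁻ _, (B : ℝ≥0∞) ^ 2 ∂(dt T) := setLIntegral_le_lintegral _ _
    _ = _ := by
        rw [lintegral_const, ENNReal.coe_mul, ENNReal.coe_toNNReal (measure_ne_top _ _),
          ENNReal.coe_pow]

/-- The permanent impact kernel, constantly `κ`. -/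
lemma isAdmissible_const (κ : ℝ) : IsAdmissible (fun _ _ : Time T => κ) :=
  isAdmissible_of_bounded measurable_const ‖κ‖₊ fun _ _ => le_rfl

/-- A square integrable convolution kernel on `[0, T]` is admissible. -/
lemma isAdmissible_conv {G : ℝ → ℝ} (hG : Measurable G)
    (hG2 : MemLp G 2 (volume.restrict (Icc 0 T))) :
    IsAdmissible (fun t s : Time T => G (t - s)) := by
  have hlt : ∫⁻ x in Icc 0 T, ‖G x‖ₑ ^ 2 < ∞ := by
    have := lintegral_rpow_enorm_lt_top_of_eLpNorm_lt_top (by norm_num) (by norm_num) hG2.2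
    simpa using this
  refine ⟨by unfold Function.uncurry; fun_prop, (∫⁻ x in Icc 0 T, ‖G x‖ₑ ^ 2).toNNReal,
    fun t => ?_⟩
  rw [ENNReal.coe_toNNReal hlt.ne]
  set F : ℝ → ℝ≥0∞ := (Icc 0 T).indicator fun x => ‖G x‖ₑ ^ 2 with hF
  have hFm : Measurable F := (hG.enorm.pow_const 2).indicator measurableSet_Icc
  calc ∫⁻ s in Iic t, ‖G (t - s)‖ₑ ^ 2 ∂(dt T)
      ≤ ∫⁻ s in Iic t, F (t - s) ∂(dt T) := by
        refine setLIntegral_mono (by fun_prop) fun s hs => ?_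
        have h1 : (t : ℝ) - s ∈ Icc 0 T :=
          ⟨sub_nonneg.2 hs, (sub_le_self _ s.2.1).trans t.2.2⟩
        rw [hF, indicator_of_mem h1]
    _ ≤ ∫⁻ s, F (t - s) ∂(dt T) := setLIntegral_le_lintegral _ _
    _ = ∫⁻ x in Icc 0 T, F (t - x) := by
        rw [dt, ← map_comap_subtype_coe measurableSet_Icc,
          (MeasurableEmbedding.subtype_coe measurableSet_Icc).lintegral_map]
    _ ≤ ∫⁻ x, F (t - x) := setLIntegral_le_lintegral _ _
    _ = ∫⁻ x, F x := lintegral_sub_left_eq_self F _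
    _ = _ := lintegral_indicator measurableSet_Icc _

/-- The kernel `(φ (T - t) + ϱ) 1_{t > s}`. -/
def holdingKernel (φ ϱ : ℝ) (t s : Time T) : ℝ :=
  if (s : ℝ) < t then φ * (T - t) + ϱ else 0

lemma isAdmissible_holding (φ ϱ : ℝ) : IsAdmissible (holdingKernel (T := T) φ ϱ) := by
  refine isAdmissible_of_bounded ?_ (‖φ‖₊ * ‖T‖₊ + ‖ϱ‖₊) fun t s => ?_
  · exact Measurable.ite (measurableSet_lt (by fun_prop) (by fun_prop)) (by fun_prop)
      measurable_const
  · unfold holdingKernel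
    split_ifs
    · refine (nnnorm_add_le _ _).trans ?_
      rw [nnnorm_mul]
      gcongr
      rw [← NNReal.coe_le_coe, coe_nnnorm, coe_nnnorm, Real.norm_of_nonneg (sub_nonneg.2 t.2.2)]
      exact (sub_le_self _ t.2.1).trans (le_abs_self _)
    · simp

end Kernels

section Model

variable {Ω : Type*} [mΩ : MeasurableSpace Ω] {T : ℝ}
variable {𝓕 : Filtration (Time T) mΩ} {μ : Measure Ω}

/-- The transient impact operator `(𝒢 u)ₜ = ∫₀ᵗ G(t - s) uₛ ds`. -/
def transientOp (𝓕 : Filtration (Time T) mΩ) (μ : Measure Ω) [IsProbabilityMeasure μ]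
    {G : ℝ → ℝ} (hG : Measurable G) (hG2 : MemLp G 2 (volume.restrict (Icc 0 T))) :
    ProcL2 𝓕 μ →L[ℝ] ProcL2 𝓕 μ :=
  volterraOp (fun t s => G (t - s)) (isAdmissible_conv hG hG2)

/-- The permanent impact operator `(ℋ u)ₜ = κ ∫₀ᵗ uₛ ds`. -/
def permanentOp (𝓕 : Filtration (Time T) mΩ) (μ : Measure Ω) [IsProbabilityMeasure μ] (κ : ℝ) :
    ProcL2 𝓕 μ →L[ℝ] ProcL2 𝓕 μ :=
  volterraOp (fun _ _ => κ) (isAdmissible_const κ)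

/-- The integral operator `H_{φ, ϱ}` with kernel `(φ (T - t) + ϱ) 1_{t > s}`. -/
def holdingOp (𝓕 : Filtration (Time T) mΩ) (μ : Measure Ω) [IsProbabilityMeasure μ] (φ ϱ : ℝ) :
    ProcL2 𝓕 μ →L[ℝ] ProcL2 𝓕 μ :=
  volterraOp (holdingKernel φ ϱ) (isAdmissible_holding φ ϱ)

/-- The deterministic process `X₀ (φ (T - t) + ϱ)`. -/
def holdingDrift (𝓕 : Filtration (Time T) mΩ) (μ : Measure Ω) [IsProbabilityMeasure μ]
    (X₀ φ ϱ : ℝ) : ProcL2 𝓕 μ :=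
  ofProcess (fun p => X₀ * (φ * (T - p.1) + ϱ))
    (by
      refine MemLp.of_bound (Measurable.aestronglyMeasurable (by fun_prop))
        (|X₀| * (|φ| * |T| + |ϱ|)) (Eventually.of_forall fun p => ?_)
      rw [Real.norm_eq_abs, abs_mul]
      gcongr
      refine (abs_add_le _ _).trans ?_
      rw [abs_mul]
      have h : |T - (p.1 : ℝ)| ≤ |T| := by
        rw [abs_of_nonneg (sub_nonneg.2 p.1.2.2)]
        exact (sub_le_self _ p.1.2.1).trans (le_abs_self _)
      exact add_le_add (mul_le_mul_of_nonneg_left h (abs_nonneg _)) le_rfl)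
    ⟨fun t _ => X₀ * (φ * (T - t) + ϱ), fun i => by
      have h : Measurable fun x : Iic i => X₀ * (φ * (T - ((x : Time T) : ℝ)) + ϱ) := by fun_prop
      exact h.comp (@measurable_fst _ _ _ (𝓕 i)), Eventually.of_forall fun _ => rfl⟩

lemma mul_memLp (w : Time T × Ω → ℝ)
    (hw : ∃ g : Time T → Ω → ℝ, IsProgressive 𝓕 g ∧ w =ᵐ[(dt T).prod μ] Function.uncurry g)
    {C : ℝ} (hC : ∀ p, |w p| ≤ C) (v : ProcL2 𝓕 μ) :
    MemLp (fun p => w p * v p) 2 ((dt T).prod μ) := by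
  obtain ⟨g, hg, e⟩ := hw
  refine (Lp.memLp (v : Lp ℝ 2 ((dt T).prod μ))).of_le_mul (c := C) ?_
    (Eventually.of_forall fun p => ?_)
  · exact AEStronglyMeasurable.mul
      ⟨_, (measurable_uncurry_of_isProgressive hg).stronglyMeasurable, e⟩
      (Lp.aestronglyMeasurable _)
  · rw [norm_mul]
    gcongr
    exact hC p

lemma mul_progressive (w : Time T × Ω → ℝ)
    (hw : ∃ g : Time T → Ω → ℝ, IsProgressive 𝓕 g ∧ w =ᵐ[(dt T).prod μ] Function.uncurry g)
    (v : ProcL2 𝓕 μ) :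
    ∃ g : Time T → Ω → ℝ, IsProgressive 𝓕 g ∧
      (fun p => w p * v p) =ᵐ[(dt T).prod μ] Function.uncurry g := by
  obtain ⟨g, hg, e⟩ := hw
  obtain ⟨g', hg', e'⟩ := v.2
  exact ⟨fun t ω => g t ω * g' t ω, hg.mul hg', e.mul e'⟩

/-- Multiplication by a bounded process `w` that has a progressively measurable version. -/
def mulOp (w : Time T × Ω → ℝ)
    (hw : ∃ g : Time T → Ω → ℝ, IsProgressive 𝓕 g ∧ w =ᵐ[(dt T).prod μ] Function.uncurry g)
    {C : ℝ} (hC : ∀ p, |w p| ≤ C) : ProcL2 𝓕 μ →L[ℝ] ProcL2 𝓕 μ :=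
  LinearMap.mkContinuous
    { toFun := fun v =>
        ofProcess (fun p => w p * v p) (mul_memLp w hw hC v) (mul_progressive w hw v)
      map_add' := fun u v => by
        apply Subtype.ext
        apply Lp.ext
        refine (coeFn_ofProcess _ (mul_memLp w hw hC _) (mul_progressive w hw _)).trans
          (EventuallyEq.trans ?_ (Lp.coeFn_add _ _).symm)
        filter_upwards [Lp.coeFn_add (u : Lp ℝ 2 ((dt T).prod μ)) v,
          coeFn_ofProcess _ (mul_memLp w hw hC u) (mul_progressive w hw u),
          coeFn_ofProcess _ (mul_memLp w hw hC v) (mul_progressive w hw v)] with p h1 h2 h3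
        rw [Pi.add_apply, h2, h3, ← mul_add]
        exact congrArg _ h1
      map_smul' := fun c v => by
        apply Subtype.ext
        apply Lp.ext
        refine (coeFn_ofProcess _ (mul_memLp w hw hC _) (mul_progressive w hw _)).trans
          (EventuallyEq.trans ?_ (Lp.coeFn_smul _ _).symm)
        filter_upwards [Lp.coeFn_smul c (v : Lp ℝ 2 ((dt T).prod μ)),
          coeFn_ofProcess _ (mul_memLp w hw hC v) (mul_progressive w hw v)] with p h1 h2
        rw [Pi.smul_apply, RingHom.id_apply, h2, smul_eq_mul, mul_left_comm]
        exact congrArg _ h1 }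
    C
    (fun v => by
      refine Lp.norm_le_mul_norm_of_ae_le_mul
        (f := ((ofProcess (fun p => w p * v p) (mul_memLp w hw hC v) (mul_progressive w hw v) :
          ProcL2 𝓕 μ) : Lp ℝ 2 ((dt T).prod μ))) (g := (v : Lp ℝ 2 ((dt T).prod μ))) ?_
      filter_upwards [coeFn_ofProcess _ (mul_memLp w hw hC v) (mul_progressive w hw v)] with p h1
      rw [h1, norm_mul]
      gcongr
      exact hC p)

lemma coeFn_mulOp (w : Time T × Ω → ℝ)
    (hw : ∃ g : Time T → Ω → ℝ, IsProgressive 𝓕 g ∧ w =ᵐ[(dt T).prod μ] Function.uncurry g)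
    {C : ℝ} (hC : ∀ p, |w p| ≤ C) (v : ProcL2 𝓕 μ) :
    (mulOp w hw hC v : Time T × Ω → ℝ) =ᵐ[(dt T).prod μ] fun p => w p * v p :=
  coeFn_ofProcess _ (mul_memLp w hw hC v) (mul_progressive w hw v)

variable [IsProbabilityMeasure μ]

/-- `r` solves the resistance equation `rₜ = U((𝒢 (u - r))ₜ)`. -/
def IsResistance (U : ℝ → ℝ) (𝒢 : ProcL2 𝓕 μ →L[ℝ] ProcL2 𝓕 μ) (u r : ProcL2 𝓕 μ) : Prop :=
  (r : Time T × Ω → ℝ) =ᵐ[(dt T).prod μ] fun p => U (𝒢 (u - r) p)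

open Classical in
/-- The resistance map `R : u ↦ rᵘ`: a solution of the resistance equation, if there is one. -/
def resistance (U : ℝ → ℝ) (𝒢 : ProcL2 𝓕 μ →L[ℝ] ProcL2 𝓕 μ) (u : ProcL2 𝓕 μ) : ProcL2 𝓕 μ :=
  if h : ∃ r, IsResistance U 𝒢 u r then h.choose else 0

/-- The multiplication operator `Mᵘ`, `(Mᵘ v)ₜ = U'((𝒢 (u - R u))ₜ) vₜ`. -/
def resistanceMul {U : ℝ → ℝ} {L : ℝ≥0} (hU : LipschitzWith L U)
    (𝒢 : ProcL2 𝓕 μ →L[ℝ] ProcL2 𝓕 μ) (u : ProcL2 𝓕 μ) : ProcL2 𝓕 μ →L[ℝ] ProcL2 𝓕 μ :=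
  mulOp (fun p => deriv U (𝒢 (u - resistance U 𝒢 u) p))
    (by
      obtain ⟨g, hg, e⟩ := (𝒢 (u - resistance U 𝒢 u)).2
      exact ⟨fun t ω => deriv U (g t ω), fun i => (measurable_deriv U).comp (hg i),
        e.fun_comp (deriv U)⟩)
    (C := L) fun _ => norm_deriv_le_of_lipschitz hU

/-- The operator `A(u) = (ℋ + 𝒢) R(u) - (I + (Mᵘ 𝒢)*)⁻¹ (ℋ + 𝒢)* u`. -/
def fredholmA {U : ℝ → ℝ} {L : ℝ≥0} (hU : LipschitzWith L U)
    (𝒢 ℋ : ProcL2 𝓕 μ →L[ℝ] ProcL2 𝓕 μ) (u : ProcL2 𝓕 μ) : ProcL2 𝓕 μ :=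
  (ℋ + 𝒢) (resistance U 𝒢 u) -
    Ring.inverse (1 + ContinuousLinearMap.adjoint (resistanceMul hU 𝒢 u ∘L 𝒢))
      (ContinuousLinearMap.adjoint (ℋ + 𝒢) u)

/-- The price impact `Iᵘ = γ / 2 u + (ℋ + 𝒢) (u - rᵘ)`. -/
def impact (U : ℝ → ℝ) (𝒢 ℋ : ProcL2 𝓕 μ →L[ℝ] ProcL2 𝓕 μ) (γ : ℝ) (u : ProcL2 𝓕 μ) :
    ProcL2 𝓕 μ :=
  (γ / 2) • u + (ℋ + 𝒢) (u - resistance U 𝒢 u)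

/-- The inventory `Xᵘₜ = X₀ + ∫₀ᵗ uₛ ds`. -/
def inventory (X₀ : ℝ) (u : ProcL2 𝓕 μ) (t : Time T) (ω : Ω) : ℝ :=
  X₀ + ∫ s in Iic t, u (s, ω) ∂(dt T)

/-- The final time `T` as an element of `[0, T]`. -/
def final (hT : 0 < T) : Time T := ⟨T, hT.le, le_rfl⟩

/-- The random variable under the expectation in the performance functional,
`- ∫₀ᵀ Sᵘₜ uₜ dt + Xᵘ_T S_T - φ / 2 ∫₀ᵀ (Xᵘₜ)² dt - ϱ / 2 (Xᵘ_T)²` with `Sᵘ = S + Iᵘ`. -/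
def pnl (hT : 0 < T) (U : ℝ → ℝ) (𝒢 ℋ : ProcL2 𝓕 μ →L[ℝ] ProcL2 𝓕 μ) (S : Time T → Ω → ℝ)
    (X₀ γ φ ϱ : ℝ) (u : ProcL2 𝓕 μ) (ω : Ω) : ℝ :=
  - ∫ t, (S t ω + impact U 𝒢 ℋ γ u (t, ω)) * u (t, ω) ∂(dt T)
    + inventory X₀ u (final hT) ω * S (final hT) ω
    - φ / 2 * ∫ t, inventory X₀ u t ω ^ 2 ∂(dt T)
    - ϱ / 2 * inventory X₀ u (final hT) ω ^ 2

/-- The performance functional `J(u)`. -/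
def performance (hT : 0 < T) (U : ℝ → ℝ) (𝒢 ℋ : ProcL2 𝓕 μ →L[ℝ] ProcL2 𝓕 μ)
    (S : Time T → Ω → ℝ) (X₀ γ φ ϱ : ℝ) (u : ProcL2 𝓕 μ) : ℝ :=
  ∫ ω, pnl hT U 𝒢 ℋ S X₀ γ φ ϱ u ω ∂μ

/-- `α` is the signal `αₜ = E[S_T - Sₜ | 𝓕ₜ]`. -/
def IsAlphaSignal (hT : 0 < T) (S : Time T → Ω → ℝ) (α : ProcL2 𝓕 μ) : Prop :=
  ∀ᵐ t ∂(dt T), (fun ω => α (t, ω)) =ᵐ[μ] μ[fun ω => S (final hT) ω - S t ω | 𝓕 t]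

end Model

end MarketResistance

end

open MarketResistance

/-! In the variable `v = u - r` the resistance equation reads `v + U(𝒢 v) = u`, so everything about
`R` is a statement about the map `I + U ∘ 𝒢`. Since `𝒢` is a Volterra convolution, multiplying
processes by `exp (l t)` replaces its kernel `G(x)` by `exp (l x) G(x)`, whose `L²` norm on `[0, T]`
tends to `0` as `l → -∞`. In a weighted norm the nonlinear term is therefore a contraction, and the
Banach fixed point theorem makes `I + U ∘ 𝒢` bijective with a Lipschitz inverse. The argument
(`bijective_id_add_of_abs_sub_le`) uses only the pointwise bound `|Ψ a - Ψ b| ≤ L |𝒢 (a - b)|`, so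
it also inverts the linearization `I + Mᵘ 𝒢`.

The delicate point is differentiability. `U'` need not be continuous, and a superposition operator
`v ↦ U(v)` on `L²` is in general not Fréchet differentiable in norm. Its Taylor remainder is,
however, `q k` with a quotient `q` bounded by `2 L` that tends to `0` as `k → 0`; by dominated
convergence `‖w q‖ → 0` for each fixed `w`. Hence the remainder is `o(‖k‖)` when tested against a
fixed `w` (`isLittleO_inner_superposition`), and `o(t)` in norm along a line
(`hasLineDerivAt_superposition`). Both properties pass to `R` through the Lipschitz inverse.

The weak form suffices for `J`. By Fubini and the tower property, `performance_eq` writes `J` as a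
constant plus `⟪a - (γ / 2 u + K(u - R u)) - H u, u⟫`, in which the remainder of `R` enters at first
order only when paired with the fixed vector `K* u`; all other terms are quadratic. So `J` is
Fréchet differentiable, its gradient vanishes at local extrema, and taking adjoints of inverses
yields the Fredholm equation.

The signal requires a progressive version of `E[P_T | 𝓕 t]` for an arbitrary filtration. It is
obtained as an `L²` limit of samples on time grids (`exists_procL2_condExp`), using that `t ↦
E[E[P_T | 𝓕 t]²]` is monotone and hence continuous off a countable set. -/

namespace MarketResistance

/-! ### Exponential weights and inversion of `I + Ψ` -/

section Weight

variable {Ω : Type*} [mΩ : MeasurableSpace Ω] {T : ℝ}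
variable {𝓕 : Filtration (Time T) mΩ} {μ : Measure Ω}

lemma ProcL2.ext_ae {u v : ProcL2 𝓕 μ} (h : (u : Time T × Ω → ℝ) =ᵐ[(dt T).prod μ] v) : u = v :=
  Subtype.ext (Lp.ext h)

lemma ProcL2.coeFn_add (u v : ProcL2 𝓕 μ) :
    ((u + v : ProcL2 𝓕 μ) : Time T × Ω → ℝ) =ᵐ[(dt T).prod μ] fun p => u p + v p :=
  Lp.coeFn_add (u : Lp ℝ 2 ((dt T).prod μ)) v

lemma ProcL2.coeFn_sub (u v : ProcL2 𝓕 μ) :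
    ((u - v : ProcL2 𝓕 μ) : Time T × Ω → ℝ) =ᵐ[(dt T).prod μ] fun p => u p - v p :=
  Lp.coeFn_sub (u : Lp ℝ 2 ((dt T).prod μ)) v

lemma ProcL2.coeFn_smul (c : ℝ) (u : ProcL2 𝓕 μ) :
    ((c • u : ProcL2 𝓕 μ) : Time T × Ω → ℝ) =ᵐ[(dt T).prod μ] fun p => c * u p :=
  Lp.coeFn_smul c (u : Lp ℝ 2 ((dt T).prod μ))

lemma ProcL2.norm_le_mul_of_ae_le {c : ℝ} {u v : ProcL2 𝓕 μ}
    (h : ∀ᵐ p ∂((dt T).prod μ), |u p| ≤ c * |v p|) : ‖u‖ ≤ c * ‖v‖ :=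
  Lp.norm_le_mul_norm_of_ae_le_mul (f := (u : Lp ℝ 2 ((dt T).prod μ)))
    (g := (v : Lp ℝ 2 ((dt T).prod μ))) h

lemma ProcL2.inner_eq (u v : ProcL2 𝓕 μ) :
    inner ℝ u v = ∫ p, u p * v p ∂((dt T).prod μ) := by
  rw [Submodule.coe_inner, L2.inner_def]
  congr 1
  funext p
  simp [mul_comm]

lemma ProcL2.integrable_mul (u v : ProcL2 𝓕 μ) :
    Integrable (fun p => u p * v p) ((dt T).prod μ) :=
  (Lp.memLp (u : Lp ℝ 2 ((dt T).prod μ))).integrable_mul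
    (Lp.memLp (v : Lp ℝ 2 ((dt T).prod μ)))

/-- Multiplication by the weight `exp (l t)`. -/
noncomputable def expWeight (𝓕 : Filtration (Time T) mΩ) (μ : Measure Ω) (l : ℝ) :
    ProcL2 𝓕 μ →L[ℝ] ProcL2 𝓕 μ :=
  mulOp (fun p => Real.exp (l * p.1))
    ⟨fun t _ => Real.exp (l * t), fun i => by
      have h : Measurable fun x : Iic i => Real.exp (l * ((x : Time T) : ℝ)) := by fun_prop
      exact h.comp (@measurable_fst _ _ _ (𝓕 i)), Eventually.of_forall fun _ => rfl⟩
    (C := Real.exp (|l| * T)) fun p => by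
      rw [Real.abs_exp, Real.exp_le_exp]
      exact mul_le_mul (le_abs_self l) p.1.2.2 p.1.2.1 (abs_nonneg l)

lemma coeFn_expWeight (l : ℝ) (v : ProcL2 𝓕 μ) :
    (expWeight 𝓕 μ l v : Time T × Ω → ℝ) =ᵐ[(dt T).prod μ] fun p => Real.exp (l * p.1) * v p :=
  coeFn_mulOp _ _ _ v

lemma expWeight_neg_apply (l : ℝ) (v : ProcL2 𝓕 μ) :
    expWeight 𝓕 μ (-l) (expWeight 𝓕 μ l v) = v := by
  refine ProcL2.ext_ae ?_
  filter_upwards [coeFn_expWeight (-l) (expWeight 𝓕 μ l v), coeFn_expWeight l v] with p h1 h2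
  rw [h1, h2, ← mul_assoc, ← Real.exp_add]
  simp

/-- The positive weight multiplies both sides of a pointwise bound, so pointwise estimates, unlike
norm estimates, survive a change of weight without loss. -/
lemma norm_expWeight_le_of_ae_le (l : ℝ) {c : ℝ} {u v : ProcL2 𝓕 μ}
    (h : ∀ᵐ p ∂((dt T).prod μ), |u p| ≤ c * |v p|) :
    ‖expWeight 𝓕 μ l u‖ ≤ c * ‖expWeight 𝓕 μ l v‖ := by
  refine ProcL2.norm_le_mul_of_ae_le ?_
  filter_upwards [h, coeFn_expWeight l u, coeFn_expWeight l v] with p h1 h2 h3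
  rw [h2, h3, abs_mul, abs_mul, mul_left_comm]
  gcongr

/-- The constant built into `volterraOp` is an arbitrary choice from `IsAdmissible`; the contraction
argument needs the bound for a prescribed, small `C`. -/
lemma norm_volterraOp_le [SFinite μ] {K : Time T → Time T → ℝ} (hK : IsAdmissible K) {C : ℝ≥0}
    (hC : ∀ t, ∫⁻ s in Iic t, ‖K t s‖ₑ ^ 2 ∂(dt T) ≤ C) (u : ProcL2 𝓕 μ) :
    ‖volterraOp K hK u‖ ≤ ((dt T univ * C) ^ (1 / 2 : ℝ)).toReal * ‖u‖ := by
  change ‖(memLp_volterraFun hK u).toLp _‖ ≤ _ * ‖(u : Lp ℝ 2 ((dt T).prod μ))‖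
  rw [Lp.norm_toLp, Lp.norm_def, ← ENNReal.toReal_mul]
  refine ENNReal.toReal_mono ?_ ?_
  · refine ENNReal.mul_ne_top (ENNReal.rpow_ne_top_of_nonneg (by norm_num) ?_)
      (Lp.eLpNorm_ne_top _)
    exact ENNReal.mul_ne_top (measure_ne_top _ _) ENNReal.coe_ne_top
  · obtain ⟨g, hg, e⟩ := u.2
    rw [eLpNorm_congr_ae (volterraFun_congr K e), eLpNorm_congr_ae e]
    exact eLpNorm_volterraFun_le hK.measurable hC (measurable_uncurry_of_isProgressive hg)

lemma lintegral_conv_kernel_le {G : ℝ → ℝ} (hG : Measurable G) (t : Time T) :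
    ∫⁻ s in Iic t, ‖G (t - s)‖ₑ ^ 2 ∂(dt T) ≤ ∫⁻ x in Icc 0 T, ‖G x‖ₑ ^ 2 := by
  set F : ℝ → ℝ≥0∞ := (Icc 0 T).indicator fun x => ‖G x‖ₑ ^ 2 with hF
  have hFm : Measurable F := (hG.enorm.pow_const 2).indicator measurableSet_Icc
  calc ∫⁻ s in Iic t, ‖G (t - s)‖ₑ ^ 2 ∂(dt T)
      ≤ ∫⁻ s in Iic t, F (t - s) ∂(dt T) := by
        refine setLIntegral_mono (by fun_prop) fun s hs => ?_
        have h1 : (t : ℝ) - s ∈ Icc 0 T :=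
          ⟨sub_nonneg.2 hs, (sub_le_self _ s.2.1).trans t.2.2⟩
        rw [hF, indicator_of_mem h1]
    _ ≤ ∫⁻ s, F (t - s) ∂(dt T) := setLIntegral_le_lintegral _ _
    _ = ∫⁻ x in Icc 0 T, F (t - x) := by
        rw [dt, ← map_comap_subtype_coe measurableSet_Icc,
          (MeasurableEmbedding.subtype_coe measurableSet_Icc).lintegral_map]
    _ ≤ ∫⁻ x, F (t - x) := setLIntegral_le_lintegral _ _
    _ = ∫⁻ x, F x := lintegral_sub_left_eq_self F _
    _ = _ := lintegral_indicator measurableSet_Icc _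

/-- Dominated convergence with majorant `|G|²`. -/
lemma tendsto_lintegral_exp_mul {G : ℝ → ℝ} (hG : Measurable G)
    (hG2 : MemLp G 2 (volume.restrict (Icc 0 T))) :
    Tendsto (fun n : ℕ => ∫⁻ x in Icc 0 T, ‖Real.exp (-n * x) * G x‖ₑ ^ 2) atTop (𝓝 0) := by
  have hlt : ∫⁻ x in Icc 0 T, ‖G x‖ₑ ^ 2 < ∞ := by
    have := lintegral_rpow_enorm_lt_top_of_eLpNorm_lt_top (by norm_num) (by norm_num) hG2.2
    simpa using this
  rw [← lintegral_zero (μ := volume.restrict (Icc 0 T))]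
  refine tendsto_lintegral_of_dominated_convergence (fun x => ‖G x‖ₑ ^ 2) (fun n => by fun_prop)
    (fun n => ?_) hlt.ne ?_
  · filter_upwards [ae_restrict_mem measurableSet_Icc] with x hx
    refine pow_le_pow_left₀ zero_le ?_ 2
    rw [enorm_mul]
    refine mul_le_of_le_one_left zero_le ?_
    rw [Real.enorm_eq_ofReal (Real.exp_nonneg _), ENNReal.ofReal_le_one, Real.exp_le_one_iff,
      neg_mul, neg_nonpos]
    exact mul_nonneg n.cast_nonneg hx.1
  -- At `x = 0` the exponential factor stays equal to `1`, so this null point has to be discarded.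
  · have h0 : ∀ᵐ x ∂(volume.restrict (Icc 0 T)), x ≠ 0 := ae_restrict_of_ae (by simp [ae_iff])
    filter_upwards [ae_restrict_mem measurableSet_Icc, h0] with x hx hx0
    have hpos : 0 < x := lt_of_le_of_ne hx.1 (Ne.symm hx0)
    have h1 : Tendsto (fun n : ℕ => Real.exp (-n * x) * G x) atTop (𝓝 (0 * G x)) := by
      refine Tendsto.mul_const _ (Real.tendsto_exp_atBot.comp ?_)
      simp only [neg_mul]
      exact tendsto_neg_atTop_atBot.comp (tendsto_natCast_atTop_atTop.atTop_mul_const hpos)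
    have h2 := ((ENNReal.continuous_pow 2).tendsto _).comp h1.enorm
    simpa [Function.comp_def] using h2

variable [IsProbabilityMeasure μ]

/-- From `exp (l t) = exp (l (t - s)) exp (l s)`: conjugating a convolution by the weight only
changes its kernel. -/
lemma expWeight_transientOp {G : ℝ → ℝ} (hG : Measurable G)
    (hG2 : MemLp G 2 (volume.restrict (Icc 0 T))) (l : ℝ)
    (hGl : Measurable fun x => Real.exp (l * x) * G x)
    (hGl2 : MemLp (fun x => Real.exp (l * x) * G x) 2 (volume.restrict (Icc 0 T)))
    (v : ProcL2 𝓕 μ) :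
    expWeight 𝓕 μ l (transientOp 𝓕 μ hG hG2 v) =
      transientOp 𝓕 μ hGl hGl2 (expWeight 𝓕 μ l v) := by
  refine ProcL2.ext_ae ?_
  have h4 := volterraFun_congr (μ := μ) (fun t s : Time T => Real.exp (l * (t - s)) * G (t - s))
    (coeFn_expWeight l v)
  filter_upwards [coeFn_expWeight l (transientOp 𝓕 μ hG hG2 v),
    coeFn_volterraOp _ (isAdmissible_conv hG hG2) v,
    coeFn_volterraOp _ (isAdmissible_conv hGl hGl2) (expWeight 𝓕 μ l v), h4] with p h1 h2 h3 h4
  rw [h1, transientOp, h2, transientOp, h3, h4, volterraFun, volterraFun, ← integral_const_mul]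
  congr 1
  funext s
  rw [show Real.exp (l * (p.1 - s)) * G (p.1 - s) * (Real.exp (l * s) * v (s, p.2)) =
    (Real.exp (l * (p.1 - s)) * Real.exp (l * s)) * (G (p.1 - s) * v (s, p.2)) by ring,
    ← Real.exp_add]
  congr 2
  ring

/-- In a suitable exponentially weighted norm a transient impact operator is a contraction. -/
lemma exists_norm_expWeight_transientOp_le {G : ℝ → ℝ} (hG : Measurable G)
    (hG2 : MemLp G 2 (volume.restrict (Icc 0 T))) {ε : ℝ} (hε : 0 < ε) :
    ∃ l : ℝ, ∀ v : ProcL2 𝓕 μ,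
      ‖expWeight 𝓕 μ l (transientOp 𝓕 μ hG hG2 v)‖ ≤ ε * ‖expWeight 𝓕 μ l v‖ := by
  have hlim : Tendsto (fun n : ℕ => ((dt T univ *
      ∫⁻ x in Icc 0 T, ‖Real.exp (-n * x) * G x‖ₑ ^ 2) ^ (1 / 2 : ℝ)).toReal) atTop (𝓝 0) := by
    have h1 := ENNReal.Tendsto.const_mul (a := dt T univ) (tendsto_lintegral_exp_mul hG hG2)
      (Or.inr (measure_ne_top _ _))
    have h2 := (ENNReal.continuous_rpow_const (y := 1 / 2)).continuousAt.tendsto.comp h1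
    have h3 := (ENNReal.tendsto_toReal (by simp)).comp h2
    simpa [Function.comp_def] using h3
  have hfin := (tendsto_lintegral_exp_mul hG hG2).eventually (gt_mem_nhds ENNReal.zero_lt_top)
  obtain ⟨n, hn, hn2⟩ := ((hlim.eventually (gt_mem_nhds hε)).and hfin).exists
  have hGl : Measurable fun x => Real.exp (-(n : ℝ) * x) * G x := by fun_prop
  have hGl2 : MemLp (fun x => Real.exp (-(n : ℝ) * x) * G x) 2 (volume.restrict (Icc 0 T)) := by
    refine ⟨hGl.aestronglyMeasurable, ?_⟩
    rw [eLpNorm_eq_lintegral_rpow_enorm_toReal (by norm_num) (by norm_num)]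
    simp only [ENNReal.toReal_ofNat, ENNReal.rpow_two]
    exact ENNReal.rpow_lt_top_of_nonneg (by norm_num) hn2.ne
  refine ⟨-n, fun v => ?_⟩
  rw [expWeight_transientOp hG hG2 _ hGl hGl2]
  refine (norm_volterraOp_le (isAdmissible_conv hGl hGl2)
    (C := (∫⁻ x in Icc 0 T, ‖Real.exp (-n * x) * G x‖ₑ ^ 2).toNNReal) (fun t => ?_) _).trans ?_
  · rw [ENNReal.coe_toNNReal hn2.ne]
    exact lintegral_conv_kernel_le hGl t
  · rw [ENNReal.coe_toNNReal hn2.ne]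
    gcongr

/-- The hypothesis makes `Ψ` a contraction with factor `1 / 2` for a suitable weighted norm, which
is equivalent to the original one. It covers both `U ∘ 𝒢` and the linear map `U'(w) 𝒢`. -/
lemma bijective_id_add_of_abs_sub_le {G : ℝ → ℝ} (hG : Measurable G)
    (hG2 : MemLp G 2 (volume.restrict (Icc 0 T))) {L : ℝ≥0} {Ψ : ProcL2 𝓕 μ → ProcL2 𝓕 μ}
    (hΨ : ∀ a b, ∀ᵐ p ∂((dt T).prod μ),
      |(Ψ a - Ψ b) p| ≤ L * |transientOp 𝓕 μ hG hG2 (a - b) p|) :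
    Function.Bijective (fun v => v + Ψ v) ∧
      ∃ C : ℝ, ∀ a b, ‖a - b‖ ≤ C * ‖(a + Ψ a) - (b + Ψ b)‖ := by
  obtain ⟨l, hl⟩ := exists_norm_expWeight_transientOp_le (𝓕 := 𝓕) (μ := μ) hG hG2
    -- This choice gives `L ε ≤ 1 / 2`; the `+ 1` keeps the denominator positive when `L = 0`.
    (ε := 1 / (2 * (L + 1))) (by positivity)
  set W := expWeight 𝓕 μ l
  set W' := expWeight 𝓕 μ (-l)
  have hW'W : ∀ v, W' (W v) = v := expWeight_neg_apply l
  have hWW' : ∀ v, W (W' v) = v := fun v => by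
    have := expWeight_neg_apply (-l) v
    rwa [neg_neg] at this
  have key : ∀ a b, ‖W (Ψ a - Ψ b)‖ ≤ 1 / 2 * ‖W (a - b)‖ := fun a b => by
    refine (norm_expWeight_le_of_ae_le l (hΨ a b)).trans ?_
    calc (L : ℝ) * ‖W (transientOp 𝓕 μ hG hG2 (a - b))‖
        ≤ L * (1 / (2 * (L + 1)) * ‖W (a - b)‖) := by gcongr; exact hl _
      _ = (L / (L + 1)) * (1 / 2 * ‖W (a - b)‖) := by field_simp
      _ ≤ 1 * (1 / 2 * ‖W (a - b)‖) := by
        gcongr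
        rw [div_le_one (by positivity)]
        linarith
      _ = _ := one_mul _
  have hC : ∀ a b, ‖a - b‖ ≤ (‖W'‖ * (2 * ‖W‖)) * ‖(a + Ψ a) - (b + Ψ b)‖ := fun a b => by
    have h1 : W (a - b) = W ((a + Ψ a) - (b + Ψ b)) - W (Ψ a - Ψ b) := by
      rw [← map_sub]
      congr 1
      abel
    -- The last term is absorbed into the left side, which costs the factor `2` in the constant.
    have h2 : ‖W (a - b)‖ ≤ ‖W ((a + Ψ a) - (b + Ψ b))‖ + 1 / 2 * ‖W (a - b)‖ := by
      conv_lhs => rw [h1]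
      exact (norm_sub_le _ _).trans (by gcongr; exact key a b)
    have h3 := W.le_opNorm ((a + Ψ a) - (b + Ψ b))
    calc ‖a - b‖ = ‖W' (W (a - b))‖ := by rw [hW'W]
      _ ≤ ‖W'‖ * ‖W (a - b)‖ := W'.le_opNorm _
      _ ≤ ‖W'‖ * (2 * (‖W‖ * ‖(a + Ψ a) - (b + Ψ b)‖)) := by gcongr; linarith
      _ = _ := by ring
  refine ⟨⟨fun a b hab => ?_, fun u => ?_⟩, _, hC⟩
  · have h1 := hC a b
    simp only at hab
    rw [hab, sub_self, norm_zero, mul_zero] at h1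
    exact sub_eq_zero.1 (norm_le_zero_iff.1 h1)
  -- The equation `v = u - Ψ v` is rewritten for `y = W v`, so that the contraction takes place in
  -- the original norm and completeness applies directly.
  · have hc : ContractingWith (1 / 2) fun y => W (u - Ψ (W' y)) := by
      refine ⟨by rw [← NNReal.coe_lt_coe]; norm_num, LipschitzWith.of_dist_le_mul fun x y => ?_⟩
      have h1 := key (W' y) (W' x)
      have h2 : W (W' y - W' x) = y - x := by rw [map_sub, hWW', hWW']
      rw [h2] at h1
      rw [dist_eq_norm, dist_eq_norm, ← map_sub, sub_sub_sub_cancel_left, norm_sub_rev x y]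
      simpa using h1
    set y := hc.fixedPoint
    have hy : W (u - Ψ (W' y)) = y := hc.fixedPoint_isFixedPt
    refine ⟨W' y, ?_⟩
    have h1 : W' y = u - Ψ (W' y) := by
      conv_lhs => rw [← hy, hW'W]
    simp only
    nth_rewrite 1 [h1]
    abel

end Weight

/-! ### Pointwise Taylor quotients -/

/-- The relative first order Taylor remainder `(U (x + y) - U x - U' x y) / y`. -/
noncomputable def taylorQuot (U : ℝ → ℝ) (x y : ℝ) : ℝ :=
  (U (x + y) - U x - deriv U x * y) / y

lemma taylorQuot_mul (U : ℝ → ℝ) (x y : ℝ) :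
    taylorQuot U x y * y = U (x + y) - U x - deriv U x * y := by
  rcases eq_or_ne y 0 with rfl | hy
  · simp
  · rw [taylorQuot, div_mul_cancel₀ _ hy]

lemma abs_taylorQuot_le {U : ℝ → ℝ} {L : ℝ≥0} (hU : LipschitzWith L U) (x y : ℝ) :
    |taylorQuot U x y| ≤ 2 * L := by
  rcases eq_or_ne y 0 with rfl | hy
  · simp [taylorQuot]
  · rw [taylorQuot, abs_div, div_le_iff₀ (abs_pos.2 hy)]
    have h1 := hU.dist_le_mul (x + y) x
    rw [Real.dist_eq, Real.dist_eq, add_sub_cancel_left] at h1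
    have h2 : |deriv U x| ≤ L := norm_deriv_le_of_lipschitz hU
    calc |U (x + y) - U x - deriv U x * y| ≤ |U (x + y) - U x| + |deriv U x * y| := abs_sub _ _
      _ ≤ L * |y| + L * |y| := by rw [abs_mul]; gcongr
      _ = _ := by ring

lemma measurable_taylorQuot {U : ℝ → ℝ} (hU : Measurable U) {α : Type*} [MeasurableSpace α]
    {f g : α → ℝ} (hf : Measurable f) (hg : Measurable g) :
    Measurable fun a => taylorQuot U (f a) (g a) := by
  have := (measurable_deriv U).comp hf
  unfold taylorQuot
  exact (((hU.comp (hf.add hg)).sub (hU.comp hf)).sub (this.mul hg)).div hg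

/-- Division by zero gives the quotient the value `0` at `y = 0`, so the limit holds on the full
neighbourhood and increments that vanish somewhere cause no trouble. -/
lemma tendsto_taylorQuot {U : ℝ → ℝ} (hU : Differentiable ℝ U) (x : ℝ) :
    Tendsto (taylorQuot U x) (𝓝 0) (𝓝 0) := by
  have h := (hasDerivAt_iff_isLittleO_nhds_zero.1 (hU x).hasDerivAt).tendsto_div_nhds_zero
  refine h.congr fun y => ?_
  rw [taylorQuot, smul_eq_mul, mul_comm y]

/-! ### Differentiability of superposition operators -/

section Superposition

variable {Ω : Type*} [mΩ : MeasurableSpace Ω] {T : ℝ}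
variable {𝓕 : Filtration (Time T) mΩ} {μ : Measure Ω}

/-- `L²` convergence of the increments gives almost everywhere convergence along a subsequence, and
`(2 L w)²` dominates. Testing with a fixed `w` supplies the majorant. -/
lemma tendsto_integral_mul_taylorQuot_sq {α : Type*} [MeasurableSpace α] {ν : Measure α}
    {U : ℝ → ℝ} (hUd : Differentiable ℝ U) {L : ℝ≥0} (hU : LipschitzWith L U)
    (w v : Lp ℝ 2 ν) :
    Tendsto (fun k : Lp ℝ 2 ν => ∫ p, (w p * taylorQuot U (v p) (k p)) ^ 2 ∂ν) (𝓝 0) (𝓝 0) := by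
  refine tendsto_of_subseq_tendsto fun ks hks => ?_
  have h1 : TendstoInMeasure ν (fun n => (ks n : α → ℝ)) atTop (0 : Lp ℝ 2 ν) :=
    tendstoInMeasure_of_tendsto_Lp hks
  obtain ⟨ns, -, hns⟩ := h1.exists_seq_tendsto_ae
  refine ⟨ns, ?_⟩
  have h2 : Tendsto (fun n => ∫ p, (w p * taylorQuot U (v p) (ks (ns n) p)) ^ 2 ∂ν) atTop
      (𝓝 (∫ _, (0 : ℝ) ∂ν)) := by
    refine tendsto_integral_of_dominated_convergence (fun p => (2 * L * w p) ^ 2)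
      (fun n => ?_) ?_ (fun n => Eventually.of_forall fun p => ?_) ?_
    · exact (((Lp.stronglyMeasurable w).measurable.mul (measurable_taylorQuot
        hUd.continuous.measurable (Lp.stronglyMeasurable v).measurable
        (Lp.stronglyMeasurable _).measurable)).pow_const 2).aestronglyMeasurable
    · exact ((Lp.memLp w).const_mul (2 * L : ℝ)).integrable_sq
    · rw [norm_pow, Real.norm_eq_abs, ← sq_abs (2 * L * w p), abs_mul, abs_mul]
      rw [mul_comm]
      have h3 := (abs_taylorQuot_le hU (v p) (ks (ns n) p)).trans (le_abs_self _)
      gcongr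
    · filter_upwards [hns, Lp.coeFn_zero ℝ 2 ν] with p hp h0
      rw [h0] at hp
      have h3 := ((tendsto_taylorQuot hUd (v p)).comp hp).const_mul (w p)
      have h4 := h3.pow 2
      simpa [Function.comp_def] using h4
  simpa using h2

/-- `U` grows at most linearly; finiteness of the measure puts the constant `U 0` in `L²`. -/
lemma memLp_comp_of_lipschitz {α : Type*} [MeasurableSpace α] {ν : Measure α} [IsFiniteMeasure ν]
    {U : ℝ → ℝ} {L : ℝ≥0} (hU : LipschitzWith L U) {f : α → ℝ} (hf : MemLp f 2 ν) :
    MemLp (fun p => U (f p)) 2 ν := by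
  have h1 : MemLp (fun p => ‖U 0‖ + (L : ℝ) * ‖f p‖) 2 ν :=
    (memLp_const ‖U 0‖).add (hf.norm.const_mul (L : ℝ))
  refine h1.mono (hU.continuous.comp_aestronglyMeasurable hf.1) (Eventually.of_forall fun p => ?_)
  have h2 := hU.dist_le_mul (f p) 0
  rw [dist_eq_norm, dist_eq_norm, sub_zero] at h2
  refine le_trans ?_ (Real.le_norm_self _)
  have h3 := norm_sub_norm_le (U (f p)) (U 0)
  linarith

/-- Multiplication by `U'(v)`. -/
noncomputable def superpositionDeriv {U : ℝ → ℝ} {L : ℝ≥0} (hU : LipschitzWith L U)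
    (v : ProcL2 𝓕 μ) : ProcL2 𝓕 μ →L[ℝ] ProcL2 𝓕 μ :=
  mulOp (fun p => deriv U (v p))
    (by
      obtain ⟨g, hg, e⟩ := v.2
      exact ⟨fun t ω => deriv U (g t ω), fun i => (measurable_deriv U).comp (hg i),
        e.fun_comp (deriv U)⟩)
    (C := L) fun _ => norm_deriv_le_of_lipschitz hU

lemma coeFn_superpositionDeriv {U : ℝ → ℝ} {L : ℝ≥0} (hU : LipschitzWith L U)
    (v k : ProcL2 𝓕 μ) :
    (superpositionDeriv hU v k : Time T × Ω → ℝ) =ᵐ[(dt T).prod μ] fun p => deriv U (v p) * k p :=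
  coeFn_mulOp _ _ _ k

lemma memLp_mul_taylorQuot {U : ℝ → ℝ} {L : ℝ≥0} (hU : LipschitzWith L U) (w v k : ProcL2 𝓕 μ) :
    MemLp (fun p => w p * taylorQuot U (v p) (k p)) 2 ((dt T).prod μ) := by
  refine (Lp.memLp (w : Lp ℝ 2 ((dt T).prod μ))).of_le_mul (c := 2 * L) ?_
    (Eventually.of_forall fun p => ?_)
  · exact ((Lp.stronglyMeasurable _).measurable.mul (measurable_taylorQuot
      hU.continuous.measurable (Lp.stronglyMeasurable _).measurable
      (Lp.stronglyMeasurable _).measurable)).aestronglyMeasurable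
  · rw [norm_mul, mul_comm]
    gcongr
    exact abs_taylorQuot_le hU _ _

lemma norm_toLp_sq {α : Type*} [MeasurableSpace α] {ν : Measure α} {f : α → ℝ} (hf : MemLp f 2 ν) :
    ‖hf.toLp f‖ ^ 2 = ∫ p, f p ^ 2 ∂ν := by
  rw [← real_inner_self_eq_norm_sq, L2.inner_def]
  refine integral_congr_ae ?_
  filter_upwards [hf.coeFn_toLp] with p hp
  rw [hp]
  simp [sq]

lemma tendsto_norm_mul_taylorQuot {U : ℝ → ℝ} (hUd : Differentiable ℝ U) {L : ℝ≥0}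
    (hU : LipschitzWith L U) (w v : ProcL2 𝓕 μ) :
    Tendsto (fun k : ProcL2 𝓕 μ => ‖(memLp_mul_taylorQuot hU w v k).toLp _‖) (𝓝 0) (𝓝 0) := by
  have h1 : Tendsto (fun k : ProcL2 𝓕 μ => (k : Lp ℝ 2 ((dt T).prod μ))) (𝓝 0) (𝓝 0) :=
    continuous_subtype_val.tendsto' _ _ rfl
  have h2 := ((tendsto_integral_mul_taylorQuot_sq hUd hU (w : Lp ℝ 2 ((dt T).prod μ)) v).comp
    h1).sqrt
  rw [Real.sqrt_zero] at h2
  refine h2.congr fun k => ?_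
  rw [Function.comp_apply, ← norm_toLp_sq (memLp_mul_taylorQuot hU w v k),
    Real.sqrt_sq (norm_nonneg _)]

variable [IsProbabilityMeasure μ]

/-- The superposition operator `v ↦ U(v)`. -/
noncomputable def superposition {U : ℝ → ℝ} {L : ℝ≥0} (hU : LipschitzWith L U) (v : ProcL2 𝓕 μ) :
    ProcL2 𝓕 μ :=
  ofProcess (fun p => U (v p))
    (memLp_comp_of_lipschitz hU (Lp.memLp (v : Lp ℝ 2 ((dt T).prod μ))))
    (by
      obtain ⟨g, hg, e⟩ := v.2
      exact ⟨fun t ω => U (g t ω), fun i => hU.continuous.measurable.comp (hg i), e.fun_comp U⟩)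

lemma coeFn_superposition {U : ℝ → ℝ} {L : ℝ≥0} (hU : LipschitzWith L U) (v : ProcL2 𝓕 μ) :
    (superposition hU v : Time T × Ω → ℝ) =ᵐ[(dt T).prod μ] fun p => U (v p) :=
  coeFn_ofProcess _ _ _

lemma coeFn_superposition_remainder {U : ℝ → ℝ} {L : ℝ≥0} (hU : LipschitzWith L U)
    (v k : ProcL2 𝓕 μ) :
    ((superposition hU (v + k) - superposition hU v - superpositionDeriv hU v k : ProcL2 𝓕 μ) :
      Time T × Ω → ℝ) =ᵐ[(dt T).prod μ] fun p => taylorQuot U (v p) (k p) * k p := by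
  filter_upwards [ProcL2.coeFn_sub (superposition hU (v + k) - superposition hU v)
      (superpositionDeriv hU v k),
    ProcL2.coeFn_sub (superposition hU (v + k)) (superposition hU v),
    coeFn_superposition hU (v + k), coeFn_superposition hU v,
    coeFn_superpositionDeriv hU v k, ProcL2.coeFn_add v k] with p h1 h2 h3 h4 h5 h6
  rw [h1, h2, h3, h4, h5, h6, taylorQuot_mul]

/-- The superposition operator is Fréchet differentiable in the weak sense. -/
lemma isLittleO_inner_superposition {U : ℝ → ℝ} (hUd : Differentiable ℝ U) {L : ℝ≥0}
    (hU : LipschitzWith L U) (w v : ProcL2 𝓕 μ) :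
    (fun k : ProcL2 𝓕 μ => inner ℝ w (superposition hU (v + k) - superposition hU v -
      superpositionDeriv hU v k)) =o[𝓝 0] fun k => k := by
  refine Asymptotics.IsLittleO.of_norm_right ?_
  have h1 := ((Asymptotics.isLittleO_one_iff ℝ).2 (tendsto_norm_mul_taylorQuot hUd hU w v)).mul_isBigO
    (Asymptotics.isBigO_refl (fun k : ProcL2 𝓕 μ => ‖k‖) (𝓝 0))
  simp only [one_mul] at h1
  refine Asymptotics.IsBigO.trans_isLittleO (Asymptotics.IsBigO.of_bound 1
    (Eventually.of_forall fun k => ?_)) h1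
  -- The quotient is moved from the increment `k` to the fixed `w`; Cauchy–Schwarz then leaves `‖w
  -- q‖ ‖k‖` with `‖w q‖ → 0`.
  have h2 : inner ℝ w (superposition hU (v + k) - superposition hU v - superpositionDeriv hU v k) =
      inner ℝ ((memLp_mul_taylorQuot hU w v k).toLp _) (k : Lp ℝ 2 ((dt T).prod μ)) := by
    rw [Submodule.coe_inner, L2.inner_def, L2.inner_def]
    refine integral_congr_ae ?_
    filter_upwards [coeFn_superposition_remainder hU v k,
      (memLp_mul_taylorQuot hU w v k).coeFn_toLp] with p h3 h4
    rw [h3, h4]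
    simp only [RCLike.inner_apply, conj_trivial]
    ring
  rw [h2, one_mul, norm_mul, norm_norm, norm_norm]
  exact norm_inner_le_norm _ _

/-- The superposition operator is Gateaux differentiable. -/
lemma hasLineDerivAt_superposition {U : ℝ → ℝ} (hUd : Differentiable ℝ U) {L : ℝ≥0}
    (hU : LipschitzWith L U) (v h : ProcL2 𝓕 μ) :
    HasLineDerivAt ℝ (superposition hU) (superpositionDeriv hU v h) v h := by
  rw [HasLineDerivAt, hasDerivAt_iff_isLittleO_nhds_zero]
  have h0 : Tendsto (fun t : ℝ => t • h) (𝓝 0) (𝓝 0) := by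
    have : Continuous fun t : ℝ => t • h := by fun_prop
    simpa using this.tendsto 0
  have h1 := ((Asymptotics.isLittleO_one_iff ℝ).2
    ((tendsto_norm_mul_taylorQuot hUd hU h v).comp h0)).mul_isBigO
    (Asymptotics.isBigO_refl (fun t : ℝ => t) (𝓝 0))
  simp only [one_mul] at h1
  refine Asymptotics.IsBigO.trans_isLittleO (Asymptotics.IsBigO.of_bound 1
    (Eventually.of_forall fun t => ?_)) h1
  have h2 : superposition hU (v + (0 + t) • h) - superposition hU (v + (0 : ℝ) • h) -
      t • superpositionDeriv hU v h =
      superposition hU (v + t • h) - superposition hU v - superpositionDeriv hU v (t • h) := by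
    simp
  rw [h2, one_mul, norm_mul, Function.comp_apply, norm_norm, mul_comm]
  -- The increment is `t h` with `h` fixed, so `h` itself plays the role of the test function and
  -- the remainder is `|t| ‖h q‖`.
  refine Lp.norm_le_mul_norm_of_ae_le_mul
    (f := ((superposition hU (v + t • h) - superposition hU v - superpositionDeriv hU v (t • h) :
      ProcL2 𝓕 μ) : Lp ℝ 2 ((dt T).prod μ))) ?_
  filter_upwards [coeFn_superposition_remainder hU v (t • h),
    (memLp_mul_taylorQuot hU h v (t • h)).coeFn_toLp, ProcL2.coeFn_smul t h] with p h3 h4 h5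
  rw [h3, h4, norm_mul, norm_mul, h5, norm_mul]
  exact le_of_eq (by ring)

end Superposition

/-! ### The resistance map and its derivatives -/

section Resistance

variable {Ω : Type*} [mΩ : MeasurableSpace Ω] {T : ℝ}
variable {𝓕 : Filtration (Time T) mΩ} {μ : Measure Ω}

lemma abs_superpositionDeriv_sub_le {U : ℝ → ℝ} {L : ℝ≥0} (hU : LipschitzWith L U)
    (w : ProcL2 𝓕 μ) (𝒢 : ProcL2 𝓕 μ →L[ℝ] ProcL2 𝓕 μ)
    (a b : ProcL2 𝓕 μ) :
    ∀ᵐ p ∂((dt T).prod μ),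
      |(superpositionDeriv hU w (𝒢 a) - superpositionDeriv hU w (𝒢 b)) p| ≤
        L * |𝒢 (a - b) p| := by
  rw [← map_sub, ← map_sub]
  filter_upwards [coeFn_superpositionDeriv hU w (𝒢 (a - b))] with p h1
  rw [h1, abs_mul]
  gcongr
  exact norm_deriv_le_of_lipschitz hU

variable [IsProbabilityMeasure μ]

/-- The substitution `v = u - r`, which turns the implicit equation into the inversion of `I + U ∘
𝒢`. -/
lemma isResistance_iff {U : ℝ → ℝ} {L : ℝ≥0} (hU : LipschitzWith L U)
    (𝒢 : ProcL2 𝓕 μ →L[ℝ] ProcL2 𝓕 μ) (u r : ProcL2 𝓕 μ) :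
    IsResistance U 𝒢 u r ↔ (u - r) + superposition hU (𝒢 (u - r)) = u := by
  have h1 : (u - r) + superposition hU (𝒢 (u - r)) = u ↔ r = superposition hU (𝒢 (u - r)) := by
    rw [sub_add_eq_add_sub, sub_eq_iff_eq_add, add_right_inj, eq_comm]
  rw [h1]
  refine ⟨fun h => ProcL2.ext_ae (h.trans (coeFn_superposition hU _).symm), fun h => ?_⟩
  refine EventuallyEq.trans (EventuallyEq.of_eq ?_) (coeFn_superposition hU (𝒢 (u - r)))
  exact congrArg (fun x : ProcL2 𝓕 μ => (x : Time T × Ω → ℝ)) h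

variable {U : ℝ → ℝ} {L : ℝ≥0} (hU : LipschitzWith L U) {G : ℝ → ℝ} (hG : Measurable G)
  (hG2 : MemLp G 2 (volume.restrict (Icc 0 T)))

lemma abs_superposition_sub_le (𝒢 : ProcL2 𝓕 μ →L[ℝ] ProcL2 𝓕 μ) (a b : ProcL2 𝓕 μ) :
    ∀ᵐ p ∂((dt T).prod μ),
      |(superposition hU (𝒢 a) - superposition hU (𝒢 b)) p| ≤ L * |𝒢 (a - b) p| := by
  rw [map_sub]
  filter_upwards [ProcL2.coeFn_sub (superposition hU (𝒢 a)) (superposition hU (𝒢 b)),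
    coeFn_superposition hU (𝒢 a), coeFn_superposition hU (𝒢 b), ProcL2.coeFn_sub (𝒢 a) (𝒢 b)]
    with p h1 h2 h3 h4
  rw [h1, h2, h3, h4]
  exact hU.dist_le_mul _ _

lemma bijective_add_superposition :
    Function.Bijective fun v : ProcL2 𝓕 μ =>
      v + superposition hU (transientOp 𝓕 μ hG hG2 v) :=
  (bijective_id_add_of_abs_sub_le hG hG2 (abs_superposition_sub_le hU _)).1

include hU in
lemma isResistance_resistance (u : ProcL2 𝓕 μ) :
    IsResistance U (transientOp 𝓕 μ hG hG2) u (resistance U (transientOp 𝓕 μ hG hG2) u) := by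
  have h : ∃ r, IsResistance U (transientOp 𝓕 μ hG hG2) u r := by
    obtain ⟨v, hv⟩ := (bijective_add_superposition (𝓕 := 𝓕) (μ := μ) hU hG hG2).2 u
    refine ⟨u - v, (isResistance_iff hU _ _ _).2 ?_⟩
    rwa [sub_sub_cancel]
  rw [resistance, dif_pos h]
  exact h.choose_spec

lemma sub_resistance_add_superposition (u : ProcL2 𝓕 μ) :
    (u - resistance U (transientOp 𝓕 μ hG hG2) u) + superposition hU (transientOp 𝓕 μ hG hG2
      (u - resistance U (transientOp 𝓕 μ hG hG2) u)) = u :=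
  (isResistance_iff hU _ _ _).1 (isResistance_resistance hU hG hG2 u)

include hU in
lemma IsResistance.eq_resistance {u r : ProcL2 𝓕 μ}
    (hr : IsResistance U (transientOp 𝓕 μ hG hG2) u r) :
    r = resistance U (transientOp 𝓕 μ hG hG2) u := by
  have h := (bijective_add_superposition (𝓕 := 𝓕) (μ := μ) hU hG hG2).1
    (((isResistance_iff hU _ _ _).1 hr).trans
      (sub_resistance_add_superposition hU hG hG2 u).symm)
  exact sub_right_injective h

include hU in
-- A residual estimate: the distance from an approximate solution `v` to the true one is controlled
-- by its defect in the equation.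
lemma exists_norm_sub_resistance_le : ∃ C : ℝ, ∀ (u v : ProcL2 𝓕 μ),
    ‖(u - resistance U (transientOp 𝓕 μ hG hG2) u) - v‖ ≤
      C * ‖u - (v + superposition hU (transientOp 𝓕 μ hG hG2 v))‖ := by
  obtain ⟨C, hC⟩ := (bijective_id_add_of_abs_sub_le (𝓕 := 𝓕) (μ := μ) hG hG2
    (abs_superposition_sub_le hU _)).2
  refine ⟨C, fun u v => (hC _ v).trans_eq ?_⟩
  rw [sub_resistance_add_superposition hU hG hG2 u]

include hU in
lemma exists_norm_sub_resistance_sub_le : ∃ C : ℝ, ∀ (u v : ProcL2 𝓕 μ),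
    ‖(u - resistance U (transientOp 𝓕 μ hG hG2) u) -
      (v - resistance U (transientOp 𝓕 μ hG hG2) v)‖ ≤ C * ‖u - v‖ := by
  obtain ⟨C, hC⟩ := exists_norm_sub_resistance_le (𝓕 := 𝓕) (μ := μ) hU hG hG2
  refine ⟨C, fun u v => (hC u _).trans_eq ?_⟩
  rw [sub_resistance_add_superposition hU hG hG2 v]

/-- Because `|U'| ≤ L`, the linearization satisfies the same pointwise bound as the nonlinear map; a
bijective bounded operator on a Banach space has a bounded inverse. -/
lemma isUnit_one_add_superpositionDeriv (w : ProcL2 𝓕 μ) :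
    IsUnit (1 + superpositionDeriv hU w ∘L transientOp 𝓕 μ hG hG2) := by
  rw [ContinuousLinearMap.isUnit_iff_bijective]
  exact (bijective_id_add_of_abs_sub_le (𝓕 := 𝓕) (μ := μ) hG hG2
    (Ψ := fun v => superpositionDeriv hU w (transientOp 𝓕 μ hG hG2 v))
    (abs_superpositionDeriv_sub_le hU w _)).1

lemma isUnit_one_add_resistanceMul (u : ProcL2 𝓕 μ) :
    IsUnit (1 + resistanceMul hU (transientOp 𝓕 μ hG hG2) u ∘L transientOp 𝓕 μ hG hG2) :=
  isUnit_one_add_superpositionDeriv hU hG hG2 _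

variable (hUd : Differentiable ℝ U)

include hUd in
-- With `D` solving the linearized equation for `h`, the curve `v + t D` is an approximate solution
-- for `u + t h`; the residual estimate bounds its error by its defect.
lemma hasLineDerivAt_resistance (u h : ProcL2 𝓕 μ) :
    HasLineDerivAt ℝ (resistance U (transientOp 𝓕 μ hG hG2))
      ((1 - Ring.inverse (1 + resistanceMul hU (transientOp 𝓕 μ hG hG2) u ∘L
        transientOp 𝓕 μ hG hG2)) h) u h := by
  set 𝒢 := transientOp 𝓕 μ hG hG2
  set v := u - resistance U 𝒢 u with hv
  have hunit := isUnit_one_add_resistanceMul hU hG hG2 u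
  have hM : resistanceMul hU 𝒢 u = superpositionDeriv hU (𝒢 v) := rfl
  set B := 1 + resistanceMul hU 𝒢 u ∘L 𝒢 with hB
  set D := Ring.inverse B h with hD
  have hBD : D + superpositionDeriv hU (𝒢 v) (𝒢 D) = h := by
    have h1 : B * Ring.inverse B = 1 := Ring.mul_inverse_cancel _ hunit
    have h2 := congrArg (fun A : ProcL2 𝓕 μ →L[ℝ] ProcL2 𝓕 μ => A h) h1
    exact h2
  obtain ⟨C, hC⟩ := exists_norm_sub_resistance_le (𝓕 := 𝓕) (μ := μ) hU hG hG2
  have h1 := hasLineDerivAt_superposition hUd hU (𝒢 v) (𝒢 D)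
  rw [HasLineDerivAt, hasDerivAt_iff_isLittleO_nhds_zero] at h1 ⊢
  refine Asymptotics.IsBigO.trans_isLittleO (Asymptotics.IsBigO.of_bound C
    (Eventually.of_forall fun t => ?_)) h1
  have h2 := hC (u + t • h) (v + t • D)
  -- The defect is exactly the Taylor remainder of the superposition operator at `𝒢 v` in the
  -- direction `𝒢 D`, hence `o(t)`.
  have e1 : u + t • h - (v + t • D + superposition hU (𝒢 (v + t • D))) =
      -(superposition hU (𝒢 v + (0 + t) • 𝒢 D) - superposition hU (𝒢 v + (0 : ℝ) • 𝒢 D) -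
        t • superpositionDeriv hU (𝒢 v) (𝒢 D)) := by
    have e2 : u = v + superposition hU (𝒢 v) := (sub_resistance_add_superposition hU hG hG2 u).symm
    conv_lhs => rw [e2, ← hBD]
    simp only [zero_add, zero_smul, add_zero, map_add, map_smul, smul_add]
    abel
  have e2 : resistance U 𝒢 (u + (0 + t) • h) - resistance U 𝒢 (u + (0 : ℝ) • h) -
      t • (1 - Ring.inverse B) h =
      -(u + t • h - resistance U 𝒢 (u + t • h) - (v + t • D)) := by
    simp only [zero_add, zero_smul, add_zero, sub_apply,
      one_apply_eq_self, ← hD, smul_sub, hv]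
    abel
  rw [e2, norm_neg]
  rw [e1, norm_neg] at h2
  exact h2

include hUd in
/-- `u ↦ u - R(u)` is Fréchet differentiable in the weak sense. -/
lemma isLittleO_inner_sub_resistance (w u : ProcL2 𝓕 μ) :
    (fun k : ProcL2 𝓕 μ => inner ℝ w
      ((u + k - resistance U (transientOp 𝓕 μ hG hG2) (u + k)) -
        (u - resistance U (transientOp 𝓕 μ hG hG2) u) -
        Ring.inverse (1 + resistanceMul hU (transientOp 𝓕 μ hG hG2) u ∘L
        transientOp 𝓕 μ hG hG2) k)) =o[𝓝 0] fun k => k := by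
  set 𝒢 := transientOp 𝓕 μ hG hG2
  set v := u - resistance U 𝒢 u with hv
  have hunit := isUnit_one_add_resistanceMul hU hG hG2 u
  have hM : resistanceMul hU 𝒢 u = superpositionDeriv hU (𝒢 v) := rfl
  set B := 1 + resistanceMul hU 𝒢 u ∘L 𝒢 with hB
  set V : ProcL2 𝓕 μ → ProcL2 𝓕 μ := fun k => u + k - resistance U 𝒢 (u + k) - v with hV
  obtain ⟨C, hC⟩ := exists_norm_sub_resistance_sub_le (𝓕 := 𝓕) (μ := μ) hU hG hG2
  -- The Lipschitz bound on `u - R u` lets a remainder that is small relative to `𝒢 (V k)` count as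
  -- small relative to `k`.
  have hGV : (fun k => 𝒢 (V k)) =O[𝓝 0] fun k => k := by
    refine (𝒢.isBigO_comp V _).trans (Asymptotics.IsBigO.of_bound C
      (Eventually.of_forall fun k => ?_))
    have h0 := hC (u + k) u
    rwa [add_sub_cancel_left] at h0
  have hGV0 : Tendsto (fun k => 𝒢 (V k)) (𝓝 0) (𝓝 0) := hGV.trans_tendsto tendsto_id
  have h1 := ((isLittleO_inner_superposition hUd hU
    (ContinuousLinearMap.adjoint (Ring.inverse B) w) (𝒢 v)).comp_tendsto hGV0).trans_isBigO hGV
  refine h1.neg_left.congr_left fun k => ?_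
  -- Subtracting the equations at `u + k` and `u` gives an exact identity. Applying `B⁻¹` and moving
  -- it to the test vector as an adjoint leaves a weak remainder tested against a fixed vector.
  have e1 : B (V k) + (superposition hU (𝒢 v + 𝒢 (V k)) - superposition hU (𝒢 v) -
      superpositionDeriv hU (𝒢 v) (𝒢 (V k))) = k := by
    have e2 : u = v + superposition hU (𝒢 v) := (sub_resistance_add_superposition hU hG hG2 u).symm
    have e3 : v + V k + superposition hU (𝒢 (v + V k)) = u + k := by
      have := sub_resistance_add_superposition hU hG hG2 (u + k)
      rwa [show u + k - resistance U 𝒢 (u + k) = v + V k by simp [hV]] at this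
    have e4 : V k + superposition hU (𝒢 (v + V k)) - superposition hU (𝒢 v) = k := by
      have : u + k = v + superposition hU (𝒢 v) + k := by rw [← e2]
      rw [this] at e3
      rw [← sub_eq_zero] at e3 ⊢
      rw [← e3]
      abel
    simp only [hB, hM, add_apply, one_apply_eq_self,
      ContinuousLinearMap.comp_apply, ← map_add]
    conv_rhs => rw [← e4]
    abel
  have e2 : Ring.inverse B (B (V k)) = V k := by
    have h2 := congrArg (fun A : ProcL2 𝓕 μ →L[ℝ] ProcL2 𝓕 μ => A (V k))
      (Ring.inverse_mul_cancel _ hunit)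
    simpa using h2
  simp only [Function.comp_apply]
  rw [ContinuousLinearMap.adjoint_inner_left, ← inner_neg_right]
  congr 1
  change _ = V k - _
  have e3 : Ring.inverse B k = V k + Ring.inverse B (superposition hU (𝒢 v + 𝒢 (V k)) -
      superposition hU (𝒢 v) - superpositionDeriv hU (𝒢 v) (𝒢 (V k))) := by
    conv_lhs => rw [← e1, map_add, e2]
  rw [e3]
  abel

end Resistance

/-! ### Conditional expectation as an orthogonal projection -/

section CondExp

lemma integral_mul_condExp {Ω : Type*} {m mΩ : MeasurableSpace Ω} {μ : Measure Ω}
    [IsProbabilityMeasure μ] (hm : m ≤ mΩ) {f g : Ω → ℝ} (hf : StronglyMeasurable[m] f)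
    (hf2 : MemLp f 2 μ) (hg2 : MemLp g 2 μ) :
    ∫ ω, f ω * μ[g | m] ω ∂μ = ∫ ω, f ω * g ω ∂μ := by
  have h1 := condExp_mul_of_stronglyMeasurable_left hf (hf2.integrable_mul hg2)
    (hg2.integrable one_le_two)
  rw [← integral_condExp hm (f := fun ω => f ω * g ω)]
  exact (integral_congr_ae h1).symm

/-- Pythagoras for nested projections: the cross term `e` reduces to the square of the coarser one.
-/
lemma integral_condExp_sub_condExp_sq {Ω : Type*} {m m' mΩ : MeasurableSpace Ω} {μ : Measure Ω}
    [IsProbabilityMeasure μ] (hmm : m ≤ m') (hm' : m' ≤ mΩ) {ξ : Ω → ℝ} (hξ : MemLp ξ 2 μ) :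
    ∫ ω, (μ[ξ | m'] ω - μ[ξ | m] ω) ^ 2 ∂μ =
      ∫ ω, μ[ξ | m'] ω ^ 2 ∂μ - ∫ ω, μ[ξ | m] ω ^ 2 ∂μ := by
  have h1 : MemLp (μ[ξ | m]) 2 μ := hξ.condExp one_le_two
  have h2 : MemLp (μ[ξ | m']) 2 μ := hξ.condExp one_le_two
  have e : ∫ ω, μ[ξ | m] ω * μ[ξ | m'] ω ∂μ = ∫ ω, μ[ξ | m] ω * μ[ξ | m] ω ∂μ := by
    rw [integral_mul_condExp hm' (stronglyMeasurable_condExp.mono hmm) h1 hξ,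
      integral_mul_condExp (hmm.trans hm') stronglyMeasurable_condExp h1 hξ]
  have e2 : ∀ ω, (μ[ξ | m'] ω - μ[ξ | m] ω) ^ 2 =
      (μ[ξ | m'] ω ^ 2 + μ[ξ | m] ω * μ[ξ | m] ω) - 2 * (μ[ξ | m] ω * μ[ξ | m'] ω) :=
    fun ω => by ring
  have i1 : Integrable (fun ω => μ[ξ | m] ω * μ[ξ | m] ω) μ := h1.integrable_mul h1
  have i2 : Integrable (fun ω => μ[ξ | m] ω * μ[ξ | m'] ω) μ := h1.integrable_mul h2
  have i3 : Integrable (fun ω => μ[ξ | m'] ω ^ 2 + μ[ξ | m] ω * μ[ξ | m] ω) μ :=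
    h2.integrable_sq.add i1
  simp only [e2]
  rw [integral_sub i3 (i2.const_mul 2), integral_add h2.integrable_sq i1, integral_const_mul, e]
  simp only [sq]
  ring

end CondExp

/-! ### Time grids and progressive sampling -/

section Grid

variable {T : ℝ}

instance : NullSingletonClass (dt T) := by
  constructor
  intro x
  rw [dt, Measure.comap_apply _ Subtype.val_injective
    (fun s hs => (MeasurableEmbedding.subtype_coe measurableSet_Icc).measurableSet_image.2 hs) _
    (measurableSet_singleton x)]
  simp

/-- The largest multiple of `1 / (n + 1)` below `t`. -/
noncomputable def gridFloor (n : ℕ) (t : Time T) : Time T :=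
  ⟨⌊(t : ℝ) * (n + 1)⌋₊ / (n + 1), by positivity, by
    refine le_trans ?_ t.2.2
    rw [div_le_iff₀ (by positivity)]
    exact Nat.floor_le (mul_nonneg t.2.1 (by positivity))⟩

lemma gridFloor_le (n : ℕ) (t : Time T) : gridFloor n t ≤ t := by
  rw [← Subtype.coe_le_coe, gridFloor, div_le_iff₀ (by positivity)]
  exact Nat.floor_le (mul_nonneg t.2.1 (by positivity))

lemma monotone_gridFloor (n : ℕ) : Monotone (gridFloor (T := T) n) := fun s t hst => by
  have h : (s : ℝ) ≤ t := hst
  rw [← Subtype.coe_le_coe, gridFloor, gridFloor]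
  dsimp only
  gcongr

lemma tendsto_gridFloor (t : Time T) : Tendsto (fun n => gridFloor n t) atTop (𝓝 t) := by
  rw [tendsto_subtype_rng]
  have h1 : Tendsto (fun n : ℕ => (t : ℝ) - 1 / ((n : ℝ) + 1)) atTop (𝓝 t) := by
    simpa using (tendsto_one_div_add_atTop_nhds_zero_nat (𝕜 := ℝ)).const_sub (t : ℝ)
  refine tendsto_of_tendsto_of_tendsto_of_le_of_le h1 tendsto_const_nhds (fun n => ?_)
    fun n => gridFloor_le n t
  simp only [gridFloor]
  rw [le_div_iff₀ (by positivity), sub_mul, one_div, inv_mul_cancel₀ (by positivity)]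
  exact (Nat.sub_one_lt_floor _).le

/-- Dependence on `a` through a natural number only leaves countably many slices, so joint
measurability follows from that of each slice. -/
lemma measurable_of_factors_nat {A Ω' : Type*} [MeasurableSpace A] [MeasurableSpace Ω']
    {q : A → ℕ} (hq : Measurable q) {f : A → Ω' → ℝ} (hf : ∀ a b, q a = q b → f a = f b)
    (hm : ∀ a, Measurable (f a)) : Measurable fun p : A × Ω' => f p.1 p.2 := by
  classical
  let g : ℕ × Ω' → ℝ := fun p => if h : ∃ a, q a = p.1 then f h.choose p.2 else 0
  have hg : Measurable g := by
    refine measurable_from_prod_countable_right fun k => ?_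
    by_cases h : ∃ a, q a = k
    · simp only [g, dif_pos h]
      exact hm _
    · simp only [g, dif_neg h]
      exact measurable_const
  have e : (fun p : A × Ω' => f p.1 p.2) = g ∘ fun p => (q p.1, p.2) := by
    funext p
    have h : ∃ a, q a = q p.1 := ⟨_, rfl⟩
    simp only [g, Function.comp_apply, dif_pos h]
    rw [hf _ _ h.choose_spec]
  rw [e]
  exact hg.comp ((hq.comp measurable_fst).prodMk measurable_snd)

variable {Ω : Type*} [mΩ : MeasurableSpace Ω] {𝓕 : Filtration (Time T) mΩ} {μ : Measure Ω}

/-- Rounding down looks only into the past and takes countably many values, so adaptedness alone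
already gives progressive measurability. -/
lemma isProgressive_gridFloor {X : Time T → Ω → ℝ} (hX : ∀ t, Measurable[𝓕 t] (X t)) (n : ℕ) :
    IsProgressive 𝓕 fun t => X (gridFloor n t) := fun i => by
  refine @measurable_of_factors_nat (Iic i) Ω _ (𝓕 i)
    (fun a => ⌊((a : Time T) : ℝ) * (n + 1)⌋₊) (by fun_prop)
    (fun a => X (gridFloor n a)) (fun a b hab => ?_) fun a => ?_
  · have h : gridFloor n (a : Time T) = gridFloor n (b : Time T) := by
      apply Subtype.ext
      simp only [gridFloor]
      rw [hab]
    rw [h]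
  · exact (hX _).mono (𝓕.mono ((gridFloor_le n _).trans a.2)) le_rfl

lemma memLp_uncurry_of_eLpNorm_le [IsProbabilityMeasure μ] {g : Time T → Ω → ℝ}
    (hg : Measurable (Function.uncurry g)) {C : ℝ≥0∞} (hC : C ≠ ∞)
    (h : ∀ t, eLpNorm (g t) 2 μ ≤ C) :
    MemLp (Function.uncurry g) 2 ((dt T).prod μ) := by
  refine ⟨hg.aestronglyMeasurable, ?_⟩
  rw [eLpNorm_lt_top_iff_lintegral_rpow_enorm_lt_top (by norm_num) (by norm_num)]
  simp only [ENNReal.toReal_ofNat, ENNReal.rpow_two]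
  rw [lintegral_prod _ (by fun_prop)]
  have h1 : ∀ t, ∫⁻ ω, ‖g t ω‖ₑ ^ 2 ∂μ ≤ C ^ 2 := fun t => by
    have h2 := pow_le_pow_left₀ zero_le (h t) 2
    rw [eLpNorm_eq_lintegral_rpow_enorm_toReal (by norm_num) (by norm_num),
      ← ENNReal.rpow_natCast, ← ENNReal.rpow_mul] at h2
    simpa using h2
  calc ∫⁻ t, ∫⁻ ω, ‖g t ω‖ₑ ^ 2 ∂μ ∂(dt T) ≤ ∫⁻ _, C ^ 2 ∂(dt T) := lintegral_mono h1
    _ < ∞ := by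
      rw [lintegral_const]
      exact ENNReal.mul_lt_top (ENNReal.pow_lt_top hC.lt_top) (measure_lt_top _ _)

end Grid

/-! ### Progressive versions of square integrable martingales -/

section Version

variable {T : ℝ} {Ω : Type*} [mΩ : MeasurableSpace Ω] {μ : Measure Ω} [IsProbabilityMeasure μ]

lemma tendsto_eLpNorm_of_tendsto_integral_sq {α : Type*} [MeasurableSpace α] {ν : Measure α}
    {f : ℕ → α → ℝ} (hf : ∀ n, MemLp (f n) 2 ν)
    (h : Tendsto (fun n => ∫ x, f n x ^ 2 ∂ν) atTop (𝓝 0)) :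
    Tendsto (fun n => eLpNorm (f n) 2 ν) atTop (𝓝 0) := by
  have h1 : ∀ n, eLpNorm (f n) 2 ν = ENNReal.ofReal (√(∫ x, f n x ^ 2 ∂ν)) := fun n => by
    rw [← norm_toLp_sq (hf n), Real.sqrt_sq (norm_nonneg _), Lp.norm_toLp,
      ENNReal.ofReal_toReal (hf n).2.ne]
  simp only [h1]
  have h2 := ENNReal.tendsto_ofReal h.sqrt
  simpa using h2

/-- The martingale `E[ξ | 𝓕 t]` of a square integrable `ξ` has a version, up to `t` in a null set,
that is progressively measurable. -/
lemma exists_procL2_condExp (𝓕 : Filtration (Time T) mΩ) {ξ : Ω → ℝ} (hξ : MemLp ξ 2 μ) :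
    ∃ Y : ProcL2 𝓕 μ, ∀ᵐ t ∂(dt T), (fun ω => Y (t, ω)) =ᵐ[μ] μ[ξ | 𝓕 t] := by
  set X : Time T → Ω → ℝ := fun t => μ[ξ | 𝓕 t] with hX
  have hX2 : ∀ t, MemLp (X t) 2 μ := fun t => hξ.condExp one_le_two
  have hXm : ∀ t, Measurable[𝓕 t] (X t) := fun t => stronglyMeasurable_condExp.measurable
  set f : Time T → ℝ := fun t => ∫ ω, X t ω ^ 2 ∂μ with hf
  -- All `L²` distances between times are read off from the scalar function `f`, which is therefore
  -- monotone; no path regularity is needed.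
  have hdist : ∀ s t, s ≤ t → ∫ ω, (X t ω - X s ω) ^ 2 ∂μ = f t - f s := fun s t hst =>
    integral_condExp_sub_condExp_sq (𝓕.mono hst) (𝓕.le t) hξ
  have hmono : Monotone f := fun s t hst => by
    rw [← sub_nonneg, ← hdist s t hst]
    exact integral_nonneg fun ω => sq_nonneg _
  have hdist' : ∀ s t, ∫ ω, (X t ω - X s ω) ^ 2 ∂μ = |f t - f s| := fun s t => by
    rcases le_total s t with hst | hst
    · rw [hdist s t hst, abs_of_nonneg (sub_nonneg.2 (hmono hst))]
    · rw [abs_sub_comm, abs_of_nonneg (sub_nonneg.2 (hmono hst)), ← hdist t s hst]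
      congr 1
      funext ω
      ring
  have hfm : Measurable f := hmono.measurable
  have hgm : ∀ n, Measurable fun t => f (gridFloor n t) := fun n =>
    (hmono.comp (monotone_gridFloor n)).measurable
  -- A monotone function has countably many discontinuities, and these are `dt`-null.
  have hconv : ∀ᵐ t ∂(dt T), Tendsto (fun n => f (gridFloor n t)) atTop (𝓝 (f t)) := by
    have h0 : ∀ᵐ t ∂(dt T), ContinuousAt f t := by
      rw [ae_iff]
      exact hmono.countable_not_continuousAt.measure_zero _
    filter_upwards [h0] with t ht
    exact ht.tendsto.comp (tendsto_gridFloor t)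
  obtain ⟨B, hB⟩ : ∃ B, ∀ t, |f t| ≤ B := by
    rcases isEmpty_or_nonempty (Time T) with h | ⟨⟨t₀, ht₀⟩⟩
    · exact ⟨0, fun t => h.elim t⟩
    · refine ⟨f ⟨T, ht₀.1.trans ht₀.2, le_rfl⟩, fun t => ?_⟩
      rw [abs_of_nonneg (integral_nonneg fun ω => sq_nonneg _)]
      exact hmono t.2.2
  have hgi : ∀ n, Integrable (fun t => |f (gridFloor n t) - f t|) (dt T) := fun n =>
    Integrable.of_bound ((hgm n).sub hfm).abs.aestronglyMeasurable (2 * B)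
      (Eventually.of_forall fun t => by
        rw [Real.norm_eq_abs, abs_abs]
        refine (abs_sub _ _).trans ?_
        linarith [hB (gridFloor n t), hB t])
  have hint : Tendsto (fun n => ∫ t, |f (gridFloor n t) - f t| ∂(dt T)) atTop (𝓝 0) := by
    have h1 : Tendsto (fun n => ∫ t, |f (gridFloor n t) - f t| ∂(dt T)) atTop
        (𝓝 (∫ _, (0 : ℝ) ∂(dt T))) := by
      refine tendsto_integral_of_dominated_convergence (fun _ => 2 * B)
        (fun n => (hgi n).1) (integrable_const _) (fun n => Eventually.of_forall fun t => ?_) ?_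
      · rw [Real.norm_eq_abs, abs_abs]
        refine (abs_sub _ _).trans ?_
        linarith [hB (gridFloor n t), hB t]
      · filter_upwards [hconv] with t ht
        have h2 := (ht.sub_const (f t)).abs
        simpa using h2
    simpa using h1
  have hAp : ∀ n, IsProgressive 𝓕 fun t => X (gridFloor n t) := fun n =>
    isProgressive_gridFloor hXm n
  have hA2 : ∀ n, MemLp (Function.uncurry fun t => X (gridFloor n t)) 2 ((dt T).prod μ) :=
    fun n => memLp_uncurry_of_eLpNorm_le (measurable_uncurry_of_isProgressive (hAp n)) hξ.2.ne
      fun t => eLpNorm_condExp_le_eLpNorm _ one_le_two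
  set A : ℕ → ProcL2 𝓕 μ := fun n =>
    ofProcess _ (hA2 n) ⟨_, hAp n, EventuallyEq.rfl⟩ with hA
  have hAcoe : ∀ n, (A n : Time T × Ω → ℝ) =ᵐ[(dt T).prod μ]
      fun p => X (gridFloor n p.1) p.2 := fun n => coeFn_ofProcess _ _ _
  have hnorm : ∀ n m, ‖A n - A m‖ ^ 2 =
      ∫ t, |f (gridFloor n t) - f (gridFloor m t)| ∂(dt T) := fun n m => by
    have h1 : MemLp (fun p : Time T × Ω => X (gridFloor n p.1) p.2 - X (gridFloor m p.1) p.2) 2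
      ((dt T).prod μ) := (hA2 n).sub (hA2 m)
    have h2 : ‖A n - A m‖ ^ 2 =
        ∫ p, (X (gridFloor n p.1) p.2 - X (gridFloor m p.1) p.2) ^ 2 ∂((dt T).prod μ) := by
      rw [← norm_toLp_sq h1]
      rfl
    rw [h2, integral_prod _ h1.integrable_sq]
    congr 1
    funext t
    exact hdist' (gridFloor m t) (gridFloor n t)
  have hcauchy : CauchySeq A := by
    rw [Metric.cauchySeq_iff]
    intro ε hε
    have hε2 : 0 < ε ^ 2 / 2 := by positivity
    obtain ⟨N, hN⟩ := eventually_atTop.1 (hint.eventually (gt_mem_nhds hε2))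
    refine ⟨N, fun n hn m hm => ?_⟩
    rw [dist_eq_norm]
    refine lt_of_pow_lt_pow_left₀ 2 hε.le ?_
    rw [hnorm]
    calc ∫ t, |f (gridFloor n t) - f (gridFloor m t)| ∂(dt T)
        ≤ ∫ t, (|f (gridFloor n t) - f t| + |f (gridFloor m t) - f t|) ∂(dt T) := by
          refine integral_mono_of_nonneg (Eventually.of_forall fun t => abs_nonneg _)
            ((hgi n).add (hgi m)) (Eventually.of_forall fun t => ?_)
          simp only
          rw [abs_sub_comm (f (gridFloor m t))]
          exact abs_sub_le _ _ _
      _ = _ := integral_add (hgi n) (hgi m)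
      _ < ε ^ 2 := by linarith [hN n hn, hN m hm]
  obtain ⟨Y, hY⟩ := cauchySeq_tendsto_of_complete hcauchy
  refine ⟨Y, ?_⟩
  have h1 : TendstoInMeasure ((dt T).prod μ) (fun n => (A n : Time T × Ω → ℝ)) atTop Y :=
    tendstoInMeasure_of_tendsto_Lp
      ((continuous_subtype_val.tendsto Y).comp hY)
  obtain ⟨ns, hns, hlim⟩ := h1.exists_seq_tendsto_ae
  have h2 := Measure.ae_ae_of_ae_prod hlim
  have h3 := Measure.ae_ae_of_ae_prod (ae_all_iff.2 hAcoe)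
  filter_upwards [h2, h3, hconv] with t h2 h3 h4
  have h5 : ∀ᵐ ω ∂μ, Tendsto (fun i => X (gridFloor (ns i) t) ω) atTop (𝓝 (Y (t, ω))) := by
    filter_upwards [h2, h3] with ω h5 h6
    exact h5.congr fun i => h6 (ns i)
  have hmeas : ∀ i, AEStronglyMeasurable (X (gridFloor (ns i) t)) μ := fun i => (hX2 _).1
  -- For almost every fixed `t` the samples tend to `Y (t, ·)` almost surely along the subsequence
  -- and to `X t` in `L²`; limits in measure are unique.
  refine tendstoInMeasure_ae_unique (tendstoInMeasure_of_tendsto_ae hmeas h5)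
    (tendstoInMeasure_of_tendsto_eLpNorm two_ne_zero hmeas (hX2 t).1
      (tendsto_eLpNorm_of_tendsto_integral_sq (fun i => (hX2 _).sub (hX2 t)) ?_))
  have h6 := ((h4.comp hns.tendsto_atTop).sub_const (f t)).abs
  rw [sub_self, abs_zero] at h6
  refine h6.congr fun i => ?_
  exact (hdist' _ _).symm

end Version

/-! ### Pathwise Fubini identities for the holding costs -/

section Pathwise

variable {T : ℝ}

lemma dt_real_Ici (s : Time T) : (dt T).real (Ici s) = T - s := by
  rw [measureReal_def, dt, Measure.comap_apply _ Subtype.val_injective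
    (fun s hs => (MeasurableEmbedding.subtype_coe measurableSet_Icc).measurableSet_image.2 hs) _
    measurableSet_Ici]
  have h : (Subtype.val '' Ici s : Set ℝ) = Icc (s : ℝ) T := by
    ext x
    constructor
    · rintro ⟨y, hy, rfl⟩
      exact ⟨hy, y.2.2⟩
    · rintro ⟨h1, h2⟩
      exact ⟨⟨x, s.2.1.trans h1, h2⟩, h1, rfl⟩
  rw [h, Real.volume_Icc, ENNReal.toReal_ofReal (sub_nonneg.2 s.2.2)]

lemma dt_real_univ (hT : 0 < T) : (dt T).real univ = T := by
  have h : (univ : Set (Time T)) = Ici ⟨0, le_rfl, hT.le⟩ := by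
    ext s
    exact ⟨fun _ => s.2.1, fun _ => mem_univ s⟩
  rw [h, dt_real_Ici, sub_zero]

lemma Iic_final (hT : 0 < T) : Iic (final hT) = univ := by
  ext s
  exact ⟨fun _ => mem_univ s, fun _ => s.2.2⟩

/-- Fubini on the triangle `s ≤ t`; the weight `T - s` is the length of `[s, T]`. -/
lemma integral_setIntegral_Iic {g : Time T → ℝ} (hg : Integrable g (dt T)) :
    Integrable (fun t => ∫ s in Iic t, g s ∂(dt T)) (dt T) ∧
      ∫ t, ∫ s in Iic t, g s ∂(dt T) ∂(dt T) = ∫ s, (T - s) * g s ∂(dt T) := by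
  have hm : MeasurableSet {q : Time T × Time T | q.2 ≤ q.1} :=
    measurableSet_le measurable_snd measurable_fst
  have hi : Integrable ({q : Time T × Time T | q.2 ≤ q.1}.indicator fun q => g q.2)
      ((dt T).prod (dt T)) := (hg.comp_snd (dt T)).indicator hm
  have e1 : ∀ t, ∫ s, {q : Time T × Time T | q.2 ≤ q.1}.indicator (fun q => g q.2) (t, s) ∂(dt T) =
      ∫ s in Iic t, g s ∂(dt T) := fun t => by
    rw [← integral_indicator measurableSet_Iic]
    rfl
  have e2 : ∀ s, ∫ t, {q : Time T × Time T | q.2 ≤ q.1}.indicator (fun q => g q.2) (t, s) ∂(dt T) =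
      (T - s) * g s := fun s => by
    rw [← dt_real_Ici s, ← smul_eq_mul, ← setIntegral_const, ← integral_indicator measurableSet_Ici]
    rfl
  constructor
  · exact hi.integral_prod_left.congr (Eventually.of_forall e1)
  · simp only [← e1, ← e2]
    exact integral_integral_swap
      (f := fun t s => {q : Time T × Time T | q.2 ≤ q.1}.indicator (fun q => g q.2) (t, s)) hi

/-- The square integral splits into two triangles exchanged by symmetry, with a null diagonal. A
general `ν` allows restriction to `[0, t]`, which gives the identity for running integrals. -/
lemma sq_integral_eq_two_mul {ν : Measure (Time T)} [IsFiniteMeasure ν] [NullSingletonClass ν]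
    {f : Time T → ℝ} (hf : Integrable f ν) :
    Integrable (fun s => (∫ r in Iic s, f r ∂ν) * f s) ν ∧
      (∫ s, f s ∂ν) ^ 2 = 2 * ∫ s, (∫ r in Iic s, f r ∂ν) * f s ∂ν := by
  have hm : MeasurableSet {q : Time T × Time T | q.2 ≤ q.1} :=
    measurableSet_le measurable_snd measurable_fst
  have hi : Integrable ({q : Time T × Time T | q.2 ≤ q.1}.indicator fun q => f q.1 * f q.2)
      (ν.prod ν) := (hf.mul_prod hf).indicator hm
  have e1 : ∀ s, ∫ r, {q : Time T × Time T | q.2 ≤ q.1}.indicator (fun q => f q.1 * f q.2) (s, r) ∂ν =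
      (∫ r in Iic s, f r ∂ν) * f s := fun s => by
    rw [mul_comm, ← integral_const_mul, ← integral_indicator measurableSet_Iic]
    rfl
  have e2 : ∀ r, ∫ s, {q : Time T × Time T | q.2 ≤ q.1}.indicator (fun q => f q.1 * f q.2) (s, r) ∂ν =
      (∫ s in Ioi r, f s ∂ν) * f r := fun r => by
    rw [setIntegral_congr_set (Ioi_ae_eq_Ici (μ := ν)), ← integral_mul_const,
      ← integral_indicator measurableSet_Ici]
    rfl
  have i1 : Integrable (fun s => (∫ r in Iic s, f r ∂ν) * f s) ν :=
    hi.integral_prod_left.congr (Eventually.of_forall e1)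
  have i2 : Integrable (fun s => (∫ r in Ioi s, f r ∂ν) * f s) ν :=
    hi.integral_prod_right.congr (Eventually.of_forall e2)
  refine ⟨i1, ?_⟩
  have e3 : ∫ s, (∫ r in Ioi s, f r ∂ν) * f s ∂ν = ∫ s, (∫ r in Iic s, f r ∂ν) * f s ∂ν := by
    simp only [← e1, ← e2]
    exact (integral_integral_swap (f := fun s r =>
      {q : Time T × Time T | q.2 ≤ q.1}.indicator (fun q => f q.1 * f q.2) (s, r)) hi).symm
  calc (∫ s, f s ∂ν) ^ 2 = ∫ s, (∫ r, f r ∂ν) * f s ∂ν := by rw [integral_const_mul, sq]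
    _ = ∫ s, ((∫ r in Iic s, f r ∂ν) * f s + (∫ r in Ioi s, f r ∂ν) * f s) ∂ν := by
      congr 1
      funext s
      rw [← add_mul, ← setIntegral_univ (μ := ν), ← Iic_union_Ioi (a := s),
        setIntegral_union (Iic_disjoint_Ioi le_rfl) measurableSet_Ioi hf.integrableOn
        hf.integrableOn]
    _ = _ := by rw [integral_add i1 i2, e3, two_mul]

lemma sq_setIntegral_Iic_eq {f : Time T → ℝ} (hf : Integrable f (dt T)) (t : Time T) :
    (∫ s in Iic t, f s ∂(dt T)) ^ 2 =
      ∫ s in Iic t, 2 * ((∫ r in Iic s, f r ∂(dt T)) * f s) ∂(dt T) := by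
  rw [(sq_integral_eq_two_mul (ν := (dt T).restrict (Iic t)) hf.restrict).2, integral_const_mul]
  congr 1
  refine setIntegral_congr_fun measurableSet_Iic fun s hs => ?_
  rw [Measure.restrict_restrict measurableSet_Iic, Iic_inter_Iic, inf_eq_left.2 hs]

/-- The kernel vanishes on the diagonal `s = t`, a null set, so `Iic t` may be exchanged for `Iio
t`. -/
lemma setIntegral_holdingKernel (φ ϱ : ℝ) (f : Time T → ℝ) (t : Time T) :
    ∫ s in Iic t, holdingKernel φ ϱ t s * f s ∂(dt T) =
      (φ * (T - t) + ϱ) * ∫ s in Iic t, f s ∂(dt T) := by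
  rw [← integral_const_mul, ← setIntegral_congr_set (Iio_ae_eq_Iic (μ := dt T)),
    ← setIntegral_congr_set (Iio_ae_eq_Iic (μ := dt T))]
  refine setIntegral_congr_fun measurableSet_Iio fun s hs => ?_
  have h : (s : ℝ) < t := hs
  simp only [holdingKernel, if_pos h]

/-- The holding costs along a path, as a linear and a quadratic functional. -/
lemma holding_cost_eq (hT : 0 < T) (X₀ φ ϱ : ℝ) {f : Time T → ℝ} (hf : Integrable f (dt T)) :
    Integrable (fun t => X₀ * (φ * (T - t) + ϱ) * f t +
      (∫ s in Iic t, holdingKernel φ ϱ t s * f s ∂(dt T)) * f t) (dt T) ∧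
    φ / 2 * ∫ t, (X₀ + ∫ s in Iic t, f s ∂(dt T)) ^ 2 ∂(dt T)
      + ϱ / 2 * (X₀ + ∫ s in Iic (final hT), f s ∂(dt T)) ^ 2 =
    φ / 2 * X₀ ^ 2 * T + ϱ / 2 * X₀ ^ 2 + ∫ t, (X₀ * (φ * (T - t) + ϱ) * f t +
      (∫ s in Iic t, holdingKernel φ ϱ t s * f s ∂(dt T)) * f t) ∂(dt T) := by
  set F : Time T → ℝ := fun t => ∫ s in Iic t, f s ∂(dt T) with hF
  have hbd : ∀ {g : Time T → ℝ}, Integrable g (dt T) →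
      Integrable (fun t : Time T => (T - t) * g t) (dt T) := fun {g} hg =>
    hg.bdd_mul (c := T) (Measurable.aestronglyMeasurable (by fun_prop))
      (Eventually.of_forall fun t => by
        rw [Real.norm_of_nonneg (sub_nonneg.2 t.2.2)]
        exact sub_le_self _ t.2.1)
  have hFf : Integrable (fun t => F t * f t) (dt T) := (sq_integral_eq_two_mul hf).1
  have hsq : ∀ t, F t ^ 2 = ∫ s in Iic t, 2 * (F s * f s) ∂(dt T) := sq_setIntegral_Iic_eq hf
  have hF1 := integral_setIntegral_Iic hf
  -- Since `F t ^ 2` is the running integral of `2 F f`, Fubini turns `∫ F²` into `2 ∫ (T - t) F f`: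
  -- this is the source of the factor `φ (T - t)` in the holding kernel.
  have hF2 := integral_setIntegral_Iic (hFf.const_mul 2)
  simp only [← hsq] at hF2
  have hfin : (∫ s, f s ∂(dt T)) ^ 2 = 2 * ∫ s, F s * f s ∂(dt T) := (sq_integral_eq_two_mul hf).2
  have e1 : ∀ t : Time T, X₀ * (φ * (T - t) + ϱ) * f t +
      (∫ s in Iic t, holdingKernel φ ϱ t s * f s ∂(dt T)) * f t =
      (X₀ * φ * ((T - t) * f t) + X₀ * ϱ * f t) +
        (φ * ((T - t) * (F t * f t)) + ϱ * (F t * f t)) := fun t => by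
    rw [setIntegral_holdingKernel]
    ring
  have i1 : Integrable (fun t : Time T => X₀ * φ * ((T - t) * f t) + X₀ * ϱ * f t) (dt T) :=
    ((hbd hf).const_mul (X₀ * φ)).add (hf.const_mul (X₀ * ϱ))
  have i2 : Integrable (fun t : Time T => φ * ((T - t) * (F t * f t)) + ϱ * (F t * f t)) (dt T) :=
    ((hbd hFf).const_mul φ).add (hFf.const_mul ϱ)
  have e2 : ∀ t, (X₀ + F t) ^ 2 = (X₀ ^ 2 + 2 * X₀ * F t) + F t ^ 2 := fun t => by ring
  have i3 : Integrable (fun t => X₀ ^ 2 + 2 * X₀ * F t) (dt T) :=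
    (integrable_const _).add (hF1.1.const_mul _)
  simp only [e1]
  refine ⟨i1.add i2, ?_⟩
  have e3 : ∫ t, (X₀ + F t) ^ 2 ∂(dt T) = T * X₀ ^ 2 +
      2 * X₀ * ∫ t, (T - t) * f t ∂(dt T) + ∫ t, (T - t) * (2 * (F t * f t)) ∂(dt T) := by
    simp only [e2]
    rw [integral_add i3 hF2.1, integral_add (integrable_const _) (hF1.1.const_mul _),
      integral_const, integral_const_mul, hF1.2, hF2.2, dt_real_univ hT, smul_eq_mul]
  have e4 : ∫ t, (T - t) * (2 * (F t * f t)) ∂(dt T) = 2 * ∫ t, (T - t) * (F t * f t) ∂(dt T) := by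
    rw [← integral_const_mul]
    congr 1
    funext t
    ring
  change φ / 2 * ∫ t, (X₀ + F t) ^ 2 ∂(dt T) + _ = _
  rw [e3, e4, Iic_final hT, setIntegral_univ, integral_add i1 i2,
    integral_add ((hbd hf).const_mul _) (hf.const_mul _),
    integral_add ((hbd hFf).const_mul _) (hFf.const_mul _), integral_const_mul, integral_const_mul,
    integral_const_mul, integral_const_mul]
  linear_combination (ϱ / 2) * hfin

end Pathwise

/-! ### The signal and the performance functional as an inner product -/

section Performance

variable {T : ℝ} {Ω : Type*} [mΩ : MeasurableSpace Ω] {μ : Measure Ω} [IsProbabilityMeasure μ]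
variable {𝓕 : Filtration (Time T) mΩ}

/-- `M t` is a conditional expectation of `M` at time `T`, so its `L²` norm is bounded uniformly in
`t`. -/
lemma Martingale.memLp_uncurry (hT : 0 < T) {M : Time T → Ω → ℝ} (hM : Martingale M 𝓕 μ)
    (hMp : IsProgressive 𝓕 M) (hMT : MemLp (M (final hT)) 2 μ) :
    MemLp (Function.uncurry M) 2 ((dt T).prod μ) := by
  refine memLp_uncurry_of_eLpNorm_le (measurable_uncurry_of_isProgressive hMp) hMT.2.ne fun t => ?_
  rw [← eLpNorm_congr_ae (hM.2 t (final hT) t.2.2)]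
  exact eLpNorm_condExp_le_eLpNorm _ one_le_two

/-- The martingale part has conditional increment zero, so the signal is `E[P_T | 𝓕 t] - P t` and
only its first term needs a progressive version. -/
lemma exists_isAlphaSignal (hT : 0 < T) {P M : Time T → Ω → ℝ}
    (hP : IsProgressive 𝓕 P) (hP2 : MemLp (Function.uncurry P) 2 ((dt T).prod μ))
    (hPT : MemLp (P (final hT)) 2 μ) (hM : Martingale M 𝓕 μ) :
    ∃ α : ProcL2 𝓕 μ, IsAlphaSignal hT (fun t ω => P t ω + M t ω) α := by
  obtain ⟨Y, hY⟩ := exists_procL2_condExp 𝓕 hPT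
  set Q : ProcL2 𝓕 μ := ofProcess (Function.uncurry P) hP2 ⟨P, hP, EventuallyEq.rfl⟩
  have hQ : (Q : Time T × Ω → ℝ) =ᵐ[(dt T).prod μ] Function.uncurry P := coeFn_ofProcess _ _ _
  refine ⟨Y - Q, ?_⟩
  have h1 : ∀ᵐ t ∂(dt T), Integrable (P t) μ :=
    (hP2.integrable one_le_two).prod_right_ae
  filter_upwards [hY, Measure.ae_ae_of_ae_prod hQ, Measure.ae_ae_of_ae_prod (ProcL2.coeFn_sub Y Q),
    h1] with t h1 h2 h3 h4
  have hMi : ∀ t, Integrable (M t) μ := fun t => hM.integrable t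
  have hPTi : Integrable (P (final hT)) μ := hPT.integrable one_le_two
  have hSm : StronglyMeasurable[𝓕 t] (P t + M t) :=
    (hP.adapted t).stronglyMeasurable.add (hM.1 t)
  have e1 := condExp_sub (m := 𝓕 t) (hPTi.add (hMi (final hT))) (h4.add (hMi t))
  have e2 := condExp_add (m := 𝓕 t) hPTi (hMi (final hT))
  have e3 := condExp_of_stronglyMeasurable (𝓕.le t) hSm (h4.add (hMi t))
  have e0 : (fun ω => P (final hT) ω + M (final hT) ω - (P t ω + M t ω)) =
    (P (final hT) + M (final hT)) - (P t + M t) := rfl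
  rw [e0]
  filter_upwards [h1, h2, h3, e1, e2, hM.2 t (final hT) t.2.2] with ω a1 a2 a3 b1 b2 b3
  rw [a3, a1, a2, b1, Pi.sub_apply, b2, Pi.add_apply, b3, e3, Pi.add_apply]
  simp only [Function.uncurry_apply_pair]
  ring

lemma memLp_path {f : Time T × Ω → ℝ} (hf : MemLp f 2 ((dt T).prod μ)) :
    ∀ᵐ ω ∂μ, MemLp (fun s => f (s, ω)) 2 (dt T) := by
  have h1 : Integrable (fun q => f q.swap ^ 2) (μ.prod (dt T)) :=
    (Measure.measurePreserving_swap (μ := μ) (ν := dt T)).integrable_comp_of_integrable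
      hf.integrable_sq
  have h2 : AEStronglyMeasurable (fun q => f q.swap) (μ.prod (dt T)) :=
    hf.1.comp_measurePreserving (Measure.measurePreserving_swap (μ := μ) (ν := dt T))
  filter_upwards [h1.prod_right_ae, h2.prodMk_left] with ω h3 h4
  exact (memLp_two_iff_integrable_sq h4).2 h3

/-- At almost every time `u` agrees with an `𝓕 t`-measurable variable, so it can be pulled through
the conditional expectation defining `α`. -/
lemma IsAlphaSignal.integral_mul_sub (hT : 0 < T) {S : Time T → Ω → ℝ}
    (hS : MemLp (Function.uncurry S) 2 ((dt T).prod μ)) (hST : MemLp (S (final hT)) 2 μ)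
    {α : ProcL2 𝓕 μ} (hα : IsAlphaSignal hT S α) (u : ProcL2 𝓕 μ) :
    Integrable (fun p => u p * (S (final hT) p.2 - S p.1 p.2)) ((dt T).prod μ) ∧
      ∫ p, u p * (S (final hT) p.2 - S p.1 p.2) ∂((dt T).prod μ) = inner ℝ α u := by
  have hd : MemLp (fun p : Time T × Ω => S (final hT) p.2 - S p.1 p.2) 2 ((dt T).prod μ) :=
    (hST.comp_snd (dt T)).sub hS
  have hu := Lp.memLp (u : Lp ℝ 2 ((dt T).prod μ))
  have hi : Integrable (fun p => u p * (S (final hT) p.2 - S p.1 p.2)) ((dt T).prod μ) :=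
    hu.integrable_mul hd
  refine ⟨hi, ?_⟩
  rw [real_inner_comm, ProcL2.inner_eq, integral_prod _ hi, integral_prod _ (ProcL2.integrable_mul u α)]
  obtain ⟨g, hg, e⟩ := u.2
  have hsec : ∀ {f : Time T × Ω → ℝ}, MemLp f 2 ((dt T).prod μ) →
      ∀ᵐ t ∂(dt T), MemLp (fun ω => f (t, ω)) 2 μ := fun {f} hf => by
    filter_upwards [hf.integrable_sq.prod_right_ae, hf.1.prodMk_left] with t h1 h2
    exact (memLp_two_iff_integrable_sq h2).2 h1
  refine integral_congr_ae ?_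
  filter_upwards [hα, Measure.ae_ae_of_ae_prod e, hsec hd, hsec hu] with t h1 h2 h3 h4
  have h5 : MemLp (g t) 2 μ := h4.ae_eq h2
  have h6 := integral_mul_condExp (𝓕.le t) (hg.adapted t).stronglyMeasurable h5 h3
  calc ∫ ω, u (t, ω) * (S (final hT) ω - S t ω) ∂μ
      = ∫ ω, g t ω * (S (final hT) ω - S t ω) ∂μ := by
        refine integral_congr_ae ?_
        filter_upwards [h2] with ω h7
        rw [h7]
        rfl
    _ = ∫ ω, g t ω * μ[fun ω => S (final hT) ω - S t ω | 𝓕 t] ω ∂μ := h6.symm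
    _ = _ := by
        refine integral_congr_ae ?_
        filter_upwards [h1, h2] with ω h7 h8
        rw [← h7, h8]
        rfl

lemma integral_performance_integrand (hT : 0 < T) {S : Time T → Ω → ℝ}
    (hS : MemLp (Function.uncurry S) 2 ((dt T).prod μ)) (hST : MemLp (S (final hT)) 2 μ)
    {α : ProcL2 𝓕 μ} (hα : IsAlphaSignal hT S α) (X₀ φ ϱ : ℝ) (i u : ProcL2 𝓕 μ) :
    Integrable (fun p => u p * (S (final hT) p.2 - S p.1 p.2) - i p * u p -
        (X₀ * (φ * (T - p.1) + ϱ) * u p + volterraFun (holdingKernel φ ϱ) u p * u p))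
        ((dt T).prod μ) ∧
      ∫ p, (u p * (S (final hT) p.2 - S p.1 p.2) - i p * u p -
        (X₀ * (φ * (T - p.1) + ϱ) * u p + volterraFun (holdingKernel φ ϱ) u p * u p))
        ∂((dt T).prod μ) =
      inner ℝ (α - i - holdingDrift 𝓕 μ X₀ φ ϱ - holdingOp 𝓕 μ φ ϱ u) u := by
  have h1 := hα.integral_mul_sub hT hS hST u
  have e2 : (holdingDrift 𝓕 μ X₀ φ ϱ : Time T × Ω → ℝ) =ᵐ[(dt T).prod μ]
    fun p => X₀ * (φ * (T - p.1) + ϱ) := coeFn_ofProcess _ _ _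
  have e3 : (holdingOp 𝓕 μ φ ϱ u : Time T × Ω → ℝ) =ᵐ[(dt T).prod μ]
    volterraFun (holdingKernel φ ϱ) u := coeFn_volterraOp _ _ u
  have e : (fun p => u p * (S (final hT) p.2 - S p.1 p.2) - i p * u p -
        (X₀ * (φ * (T - p.1) + ϱ) * u p + volterraFun (holdingKernel φ ϱ) u p * u p))
      =ᵐ[(dt T).prod μ] fun p => u p * (S (final hT) p.2 - S p.1 p.2) - i p * u p -
        (holdingDrift 𝓕 μ X₀ φ ϱ p * u p + holdingOp 𝓕 μ φ ϱ u p * u p) := by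
    filter_upwards [e2, e3] with p h2 h3
    rw [h2, h3]
  have i1 := ProcL2.integrable_mul i u
  have i2 := ProcL2.integrable_mul (holdingDrift 𝓕 μ X₀ φ ϱ) u
  have i3 := ProcL2.integrable_mul (holdingOp 𝓕 μ φ ϱ u) u
  have i4 : Integrable (fun p => u p * (S (final hT) p.2 - S p.1 p.2) - i p * u p)
    ((dt T).prod μ) := h1.1.sub i1
  have i5 : Integrable (fun p => holdingDrift 𝓕 μ X₀ φ ϱ p * u p + holdingOp 𝓕 μ φ ϱ u p * u p)
    ((dt T).prod μ) := i2.add i3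
  refine ⟨(i4.sub i5).congr e.symm, ?_⟩
  rw [integral_congr_ae e, integral_sub i4 i5, integral_sub h1.1 i1, integral_add i2 i3, h1.2,
    inner_sub_left, inner_sub_left, inner_sub_left, ProcL2.inner_eq i u,
    ProcL2.inner_eq (holdingDrift 𝓕 μ X₀ φ ϱ) u, ProcL2.inner_eq (holdingOp 𝓕 μ φ ϱ u) u]
  ring

/-- Along each square integrable path, terminal wealth `X_T S_T` is `X₀ S_T + ∫ uₜ S_T dt`, which
merges with `-∫ Sₜ uₜ dt`; `holding_cost_eq` handles the inventory penalties. -/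
lemma pnl_ae_eq (hT : 0 < T) (U : ℝ → ℝ) (𝒢 ℋ : ProcL2 𝓕 μ →L[ℝ] ProcL2 𝓕 μ)
    {S : Time T → Ω → ℝ} (hS : MemLp (Function.uncurry S) 2 ((dt T).prod μ))
    (X₀ γ φ ϱ : ℝ) (u : ProcL2 𝓕 μ) :
    pnl hT U 𝒢 ℋ S X₀ γ φ ϱ u =ᵐ[μ] fun ω =>
      X₀ * S (final hT) ω - (φ / 2 * X₀ ^ 2 * T + ϱ / 2 * X₀ ^ 2) +
      ∫ t, (u (t, ω) * (S (final hT) ω - S t ω) - impact U 𝒢 ℋ γ u (t, ω) * u (t, ω) -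
        (X₀ * (φ * (T - t) + ϱ) * u (t, ω) +
          volterraFun (holdingKernel φ ϱ) u (t, ω) * u (t, ω))) ∂(dt T) := by
  filter_upwards [memLp_path (Lp.memLp (u : Lp ℝ 2 ((dt T).prod μ))),
    memLp_path (Lp.memLp (impact U 𝒢 ℋ γ u : Lp ℝ 2 ((dt T).prod μ))), memLp_path hS]
    with ω hu hi hs
  have hu1 : Integrable (fun t => u (t, ω)) (dt T) := hu.integrable one_le_two
  obtain ⟨j1, hcost⟩ := holding_cost_eq hT X₀ φ ϱ hu1
  have j2 : Integrable (fun t => (S t ω + impact U 𝒢 ℋ γ u (t, ω)) * u (t, ω)) (dt T) :=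
    (hs.add hi).integrable_mul hu
  have j3 : Integrable (fun t => S (final hT) ω * u (t, ω)) (dt T) := hu1.const_mul _
  have e1 : ∀ t, u (t, ω) * (S (final hT) ω - S t ω) - impact U 𝒢 ℋ γ u (t, ω) * u (t, ω) -
        (X₀ * (φ * (T - t) + ϱ) * u (t, ω) +
          volterraFun (holdingKernel φ ϱ) u (t, ω) * u (t, ω)) =
      S (final hT) ω * u (t, ω) - (S t ω + impact U 𝒢 ℋ γ u (t, ω)) * u (t, ω) -
        (X₀ * (φ * (T - t) + ϱ) * u (t, ω) +
          (∫ s in Iic t, holdingKernel φ ϱ t s * u (s, ω) ∂(dt T)) * u (t, ω)) := fun t => by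
    rw [volterraFun]
    ring
  have j4 : Integrable (fun t => S (final hT) ω * u (t, ω) -
    (S t ω + impact U 𝒢 ℋ γ u (t, ω)) * u (t, ω)) (dt T) := j3.sub j2
  simp only [e1]
  rw [integral_sub j4 j1, integral_sub j3 j2, integral_const_mul]
  simp only [pnl, inventory]
  rw [Iic_final hT, setIntegral_univ] at hcost ⊢
  linear_combination -hcost

/-- The random variable in the performance functional is integrable, and the performance
functional is a constant plus a quadratic form with a nonlinear perturbation. -/
lemma performance_eq (hT : 0 < T) (U : ℝ → ℝ) (𝒢 ℋ : ProcL2 𝓕 μ →L[ℝ] ProcL2 𝓕 μ)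
    {S : Time T → Ω → ℝ} (hS : MemLp (Function.uncurry S) 2 ((dt T).prod μ))
    (hST : MemLp (S (final hT)) 2 μ) {α : ProcL2 𝓕 μ} (hα : IsAlphaSignal hT S α)
    (X₀ γ φ ϱ : ℝ) (u : ProcL2 𝓕 μ) :
    Integrable (pnl hT U 𝒢 ℋ S X₀ γ φ ϱ u) μ ∧
    performance hT U 𝒢 ℋ S X₀ γ φ ϱ u =
      (X₀ * ∫ ω, S (final hT) ω ∂μ - (φ / 2 * X₀ ^ 2 * T + ϱ / 2 * X₀ ^ 2)) +
      inner ℝ (α - impact U 𝒢 ℋ γ u - holdingDrift 𝓕 μ X₀ φ ϱ - holdingOp 𝓕 μ φ ϱ u) u := by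
  have h1 := pnl_ae_eq hT U 𝒢 ℋ hS X₀ γ φ ϱ u
  have h2 := integral_performance_integrand hT hS hST hα X₀ φ ϱ (impact U 𝒢 ℋ γ u) u
  have i1 : Integrable (fun ω => X₀ * S (final hT) ω) μ :=
    (hST.integrable one_le_two).const_mul X₀
  have i2 : Integrable (fun ω => X₀ * S (final hT) ω -
    (φ / 2 * X₀ ^ 2 * T + ϱ / 2 * X₀ ^ 2)) μ := i1.sub (integrable_const _)
  have i3 := h2.1.integral_prod_right
  refine ⟨(i2.add i3).congr h1.symm, ?_⟩
  rw [← h2.2, performance, integral_congr_ae h1, integral_add i2 i3,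
    integral_sub i1 (integrable_const _), integral_const_mul, integral_prod_symm _ h2.1]
  simp

end Performance

/-! ### The gradient and the first order condition -/

section Gradient

variable {T : ℝ} {Ω : Type*} [mΩ : MeasurableSpace Ω] {μ : Measure Ω} [IsProbabilityMeasure μ]
variable {𝓕 : Filtration (Time T) mΩ}

/-- A functional `c + ⟪a - (γ / 2 u + K (v u)) - H u, u⟫` with a Lipschitz map `v` that is
differentiable in the weak sense is Fréchet differentiable. -/
lemma hasGradientAt_inner_of_isLittleO {E : Type*} [NormedAddCommGroup E] [InnerProductSpace ℝ E]
    [CompleteSpace E] {v : E → E} {C : ℝ} (hv : ∀ a b, ‖v a - v b‖ ≤ C * ‖a - b‖)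
    (u : E) {v' : E →L[ℝ] E}
    (hv' : ∀ w, (fun k => inner ℝ w (v (u + k) - v u - v' k)) =o[𝓝 0] fun k => k)
    (c γ : ℝ) (a : E) (K H : E →L[ℝ] E) :
    HasGradientAt (fun u => c + inner ℝ (a - ((γ / 2) • u + K (v u)) - H u) u)
      (a - γ • u - K (v u) - ContinuousLinearMap.adjoint (K ∘L v') u
        - (H + ContinuousLinearMap.adjoint H) u) u := by
  rw [hasGradientAt_iff_isLittleO_nhds_zero]
  have hV : (fun k => v (u + k) - v u) =O[𝓝 0] fun k => k :=
    Asymptotics.IsBigO.of_bound C (Eventually.of_forall fun k => by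
      simpa using hv (u + k) u)
  -- This is minus the increment of the left factor of the inner product; paired with `k` it is of
  -- second order.
  have h1 : (fun k => (γ / 2) • k + K (v (u + k) - v u) + H k) =O[𝓝 0] fun k => k :=
    ((Asymptotics.isBigO_refl (fun k : E => k) _).const_smul_left (γ / 2) |>.add
      ((K.isBigO_comp _ _).trans hV)).add (H.isBigO_id _)
  have h2 : (fun k => inner ℝ ((γ / 2) • k + K (v (u + k) - v u) + H k) k) =o[𝓝 0]
      fun k => k := by
    have h3 : (fun k : E => ‖k‖ * ‖k‖) =o[𝓝 0] fun k => k := by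
      have h4 : (fun k : E => ‖k‖) =o[𝓝 0] fun _ => (1 : ℝ) :=
        (Asymptotics.isLittleO_one_iff ℝ).2 tendsto_norm_zero
      have h5 := h4.mul_isBigO (Asymptotics.isBigO_refl (fun k : E => ‖k‖) (𝓝 0))
      simp only [one_mul] at h5
      exact h5.of_norm_right
    refine Asymptotics.IsBigO.trans_isLittleO ?_ h3
    refine Asymptotics.IsBigO.trans (Asymptotics.IsBigO.of_bound 1
      (Eventually.of_forall fun k => ?_)) (h1.norm_norm.mul
        (Asymptotics.isBigO_refl (fun k : E => ‖k‖) (𝓝 0)))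
    rw [one_mul, norm_mul, norm_norm, norm_norm]
    exact norm_inner_le_norm _ _
  -- Paired with `u`, the same increment leaves beyond its linear part only `⟪K* u, remainder of
  -- v⟫`, so weak differentiability of `v` is enough.
  refine ((hv' (ContinuousLinearMap.adjoint K u)).add h2).neg_left.congr_left fun k => ?_
  simp only [ContinuousLinearMap.adjoint_inner_left, inner_add_left, inner_sub_left,
    inner_add_right, inner_sub_right, map_add, map_sub, inner_smul_left,
    add_apply, ContinuousLinearMap.comp_apply, smul_add, conj_trivial, real_inner_comm]
  ring

/-- The adjoint is the star operation, and `Ring.inverse` commutes with `star` even at non-units, so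
invertibility need not be assumed. -/
lemma adjoint_comp_inverse_apply {E : Type*} [NormedAddCommGroup E] [InnerProductSpace ℝ E]
    [CompleteSpace E] (K B : E →L[ℝ] E) (u : E) :
    ContinuousLinearMap.adjoint (K ∘L Ring.inverse (1 + B)) u =
      Ring.inverse (1 + ContinuousLinearMap.adjoint B) (ContinuousLinearMap.adjoint K u) := by
  rw [ContinuousLinearMap.adjoint_comp, ContinuousLinearMap.comp_apply,
    ← ContinuousLinearMap.star_eq_adjoint (Ring.inverse (1 + B)), ← Ring.inverse_star, star_add,
    star_one, ContinuousLinearMap.star_eq_adjoint]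

lemma add_sub_eq_of_gradient_eq_zero {E : Type*} [NormedAddCommGroup E] [InnerProductSpace ℝ E]
    [CompleteSpace E] {K B N : E →L[ℝ] E} {γ : ℝ} {a u r : E}
    (h : a - γ • u - K (u - r) - ContinuousLinearMap.adjoint
      (K ∘L (1 - (1 - Ring.inverse (1 + B)))) u - N u = 0) :
    γ • u + K u + N u - (K r - Ring.inverse (1 + ContinuousLinearMap.adjoint B)
      (ContinuousLinearMap.adjoint K u)) = a := by
  rw [sub_sub_cancel, adjoint_comp_inverse_apply, map_sub] at h
  rw [← sub_eq_zero, ← neg_eq_zero, ← h]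
  abel

lemma IsLocalExtr.hasGradientAt_eq_zero {E : Type*} [NormedAddCommGroup E] [InnerProductSpace ℝ E]
    [CompleteSpace E] {f : E → ℝ} {g u : E} (hu : IsLocalExtr f u) (hg : HasGradientAt f g u) :
    g = 0 := by
  have h0 := hu.hasFDerivAt_eq_zero hg.hasFDerivAt
  rwa [map_eq_zero_iff _ (InnerProductSpace.toDual ℝ E).injective] at h0

lemma isUnit_one_add_adjoint {E : Type*} [NormedAddCommGroup E] [InnerProductSpace ℝ E]
    [CompleteSpace E] {B : E →L[ℝ] E} (hB : IsUnit (1 + B)) :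
    IsUnit (1 + ContinuousLinearMap.adjoint B) := by
  have h := hB.star
  rwa [star_add, star_one, ContinuousLinearMap.star_eq_adjoint] at h

/-- The gradient of the performance functional. -/
lemma hasGradientAt_performance (hT : 0 < T) {U : ℝ → ℝ} {𝒢 ℋ : ProcL2 𝓕 μ →L[ℝ] ProcL2 𝓕 μ}
    {S : Time T → Ω → ℝ} (hS : MemLp (Function.uncurry S) 2 ((dt T).prod μ))
    (hST : MemLp (S (final hT)) 2 μ) {α : ProcL2 𝓕 μ} (hα : IsAlphaSignal hT S α)
    (X₀ γ φ ϱ : ℝ) {C : ℝ} (hC : ∀ u v : ProcL2 𝓕 μ,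
      ‖(u - resistance U 𝒢 u) - (v - resistance U 𝒢 v)‖ ≤ C * ‖u - v‖)
    {u : ProcL2 𝓕 μ} {v' : ProcL2 𝓕 μ →L[ℝ] ProcL2 𝓕 μ}
    (hv' : ∀ w, (fun k : ProcL2 𝓕 μ => inner ℝ w
      ((u + k - resistance U 𝒢 (u + k)) - (u - resistance U 𝒢 u) - v' k)) =o[𝓝 0] fun k => k)
    {D : ProcL2 𝓕 μ →L[ℝ] ProcL2 𝓕 μ} (hD : 1 - D = v') :
    HasGradientAt (performance hT U 𝒢 ℋ S X₀ γ φ ϱ)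
      (α - holdingDrift 𝓕 μ X₀ φ ϱ - γ • u - (ℋ + 𝒢) (u - resistance U 𝒢 u)
        - ContinuousLinearMap.adjoint ((ℋ + 𝒢) ∘L (1 - D)) u
        - (holdingOp 𝓕 μ φ ϱ + ContinuousLinearMap.adjoint (holdingOp 𝓕 μ φ ϱ)) u) u := by
  subst hD
  have h := hasGradientAt_inner_of_isLittleO (v := fun u => u - resistance U 𝒢 u) hC u hv'
    (X₀ * ∫ ω, S (final hT) ω ∂μ - (φ / 2 * X₀ ^ 2 * T + ϱ / 2 * X₀ ^ 2)) γ
    (α - holdingDrift 𝓕 μ X₀ φ ϱ) (ℋ + 𝒢) (holdingOp 𝓕 μ φ ϱ)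
  have e : performance hT U 𝒢 ℋ S X₀ γ φ ϱ = fun u =>
      (X₀ * ∫ ω, S (final hT) ω ∂μ - (φ / 2 * X₀ ^ 2 * T + ϱ / 2 * X₀ ^ 2)) +
      inner ℝ (α - holdingDrift 𝓕 μ X₀ φ ϱ - ((γ / 2) • u +
        (ℋ + 𝒢) (u - resistance U 𝒢 u)) - holdingOp 𝓕 μ φ ϱ u) u := by
    funext u
    rw [(performance_eq hT U 𝒢 ℋ hS hST hα X₀ γ φ ϱ u).2, impact, sub_right_comm α]
  rw [e]
  exact h

end Gradient

end MarketResistance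

/-! ### The main theorem -/

theorem mainTheorem2 {Ω : Type*} [mΩ : MeasurableSpace Ω] (μ : Measure Ω) [IsProbabilityMeasure μ]
    {T : ℝ} (hT : 0 < T) (𝓕 : Filtration (Time T) mΩ)
    -- the resistance function
    {U : ℝ → ℝ} (hUd : Differentiable ℝ U) {L : ℝ≥0} (hU : LipschitzWith L U)
    -- the transient and permanent impact operators
    {G : ℝ → ℝ} (hG : Measurable G) (hG2 : MemLp G 2 (volume.restrict (Icc 0 T))) (κ : ℝ)
    (𝒢 ℋ : ProcL2 𝓕 μ →L[ℝ] ProcL2 𝓕 μ)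
    (h𝒢 : 𝒢 = transientOp 𝓕 μ hG hG2) (hℋ : ℋ = permanentOp 𝓕 μ κ)
    -- the unaffected price `S = P + M`
    (P M S : Time T → Ω → ℝ)
    (hP : IsProgressive 𝓕 P) (hP2 : MemLp (Function.uncurry P) 2 ((dt T).prod μ))
    (hPT : MemLp (P (final hT)) 2 μ)
    (hM : Martingale M 𝓕 μ) (hMp : IsProgressive 𝓕 M) (hM2 : ∀ t, MemLp (M t) 2 μ)
    (hS : S = fun t ω => P t ω + M t ω)
    (X₀ γ φ ϱ : ℝ)
    -- the performance functional and the resistance map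
    (J : ProcL2 𝓕 μ → ℝ) (hJ : J = performance hT U 𝒢 ℋ S X₀ γ φ ϱ)
    (R : ProcL2 𝓕 μ → ProcL2 𝓕 μ) (hR : R = resistance U 𝒢) :
    -- `R u` is the unique solution of the resistance equation, and `J u` is well defined
    (∀ u, IsResistance U 𝒢 u (R u) ∧ ∀ r, IsResistance U 𝒢 u r → r = R u) ∧
    (∀ u, Integrable (pnl hT U 𝒢 ℋ S X₀ γ φ ϱ u) μ) ∧
    ∃ α : ProcL2 𝓕 μ, IsAlphaSignal hT S α ∧
    ∃ DR : ProcL2 𝓕 μ → (ProcL2 𝓕 μ →L[ℝ] ProcL2 𝓕 μ),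
      -- the directional derivative of `R`
      (∀ u h, HasLineDerivAt ℝ R (DR u h) u h) ∧
      (∀ u, IsUnit (1 + resistanceMul hU 𝒢 u ∘L 𝒢) ∧
        IsUnit (1 + ContinuousLinearMap.adjoint (resistanceMul hU 𝒢 u ∘L 𝒢)) ∧
        DR u = 1 - Ring.inverse (1 + resistanceMul hU 𝒢 u ∘L 𝒢)) ∧
      -- `J` is Fréchet differentiable, with its gradient
      (∀ u, HasGradientAt J
        (α - holdingDrift 𝓕 μ X₀ φ ϱ - γ • u - (ℋ + 𝒢) (u - R u)
          - ContinuousLinearMap.adjoint ((ℋ + 𝒢) ∘L (1 - DR u)) u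
          - (holdingOp 𝓕 μ φ ϱ + ContinuousLinearMap.adjoint (holdingOp 𝓕 μ φ ϱ)) u) u) ∧
      -- the first order conditions
      (∀ u, IsLocalExtr J u →
        α - holdingDrift 𝓕 μ X₀ φ ϱ - γ • u - (ℋ + 𝒢) (u - R u)
          - ContinuousLinearMap.adjoint ((ℋ + 𝒢) ∘L (1 - DR u)) u
          - (holdingOp 𝓕 μ φ ϱ + ContinuousLinearMap.adjoint (holdingOp 𝓕 μ φ ϱ)) u = 0 ∧
        γ • u + (ℋ + 𝒢) u
          + (holdingOp 𝓕 μ φ ϱ + ContinuousLinearMap.adjoint (holdingOp 𝓕 μ φ ϱ)) u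
          - fredholmA hU 𝒢 ℋ u = α - holdingDrift 𝓕 μ X₀ φ ϱ) := by
  subst hR hJ
  have hres : ∀ u, IsResistance U 𝒢 u (resistance U 𝒢 u) ∧
      ∀ r, IsResistance U 𝒢 u r → r = resistance U 𝒢 u := by
    subst h𝒢
    exact fun u => ⟨isResistance_resistance hU hG hG2 u, fun r hr => hr.eq_resistance hU hG hG2⟩
  have hunit : ∀ u, IsUnit (1 + resistanceMul hU 𝒢 u ∘L 𝒢) := by
    subst h𝒢
    exact isUnit_one_add_resistanceMul hU hG hG2
  have hline : ∀ u h, HasLineDerivAt ℝ (resistance U 𝒢)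
      ((1 - Ring.inverse (1 + resistanceMul hU 𝒢 u ∘L 𝒢)) h) u h := by
    subst h𝒢
    exact hasLineDerivAt_resistance hU hG hG2 hUd
  have hweak : ∀ u w, (fun k : ProcL2 𝓕 μ => inner ℝ w
      ((u + k - resistance U 𝒢 (u + k)) - (u - resistance U 𝒢 u) -
        Ring.inverse (1 + resistanceMul hU 𝒢 u ∘L 𝒢) k)) =o[𝓝 0] fun k => k := by
    subst h𝒢
    exact fun u w => isLittleO_inner_sub_resistance hU hG hG2 hUd w u
  have hlip : ∃ C : ℝ, ∀ u v : ProcL2 𝓕 μ,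
      ‖(u - resistance U 𝒢 u) - (v - resistance U 𝒢 v)‖ ≤ C * ‖u - v‖ := by
    subst h𝒢
    exact exists_norm_sub_resistance_sub_le hU hG hG2
  obtain ⟨C, hC⟩ := hlip
  have hS2 : MemLp (Function.uncurry S) 2 ((dt T).prod μ) := by
    rw [hS]
    exact hP2.add (Martingale.memLp_uncurry hT hM hMp (hM2 _))
  have hST : MemLp (S (final hT)) 2 μ := by
    rw [hS]
    exact hPT.add (hM2 _)
  have hsignal : ∃ α : ProcL2 𝓕 μ, IsAlphaSignal hT S α := by
    rw [hS]
    exact exists_isAlphaSignal hT hP hP2 hPT hM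
  obtain ⟨α, hα⟩ := hsignal
  have hperf := performance_eq hT U 𝒢 ℋ hS2 hST hα X₀ γ φ ϱ
  -- With `DR u = 1 - (1 + Mᵘ 𝒢)⁻¹`, the operator `1 - DR u` is `(1 + Mᵘ 𝒢)⁻¹`, the weak derivative
  -- of `u - R u`.
  have hgrad := fun u => hasGradientAt_performance (ℋ := ℋ) hT hS2 hST hα X₀ γ φ ϱ hC (hweak u)
    (sub_sub_cancel 1 (Ring.inverse (1 + resistanceMul hU 𝒢 u ∘L 𝒢)))
  refine ⟨hres, fun u => (hperf u).1, α, hα,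
    fun u => 1 - Ring.inverse (1 + resistanceMul hU 𝒢 u ∘L 𝒢),
    hline,
    fun u => ⟨hunit u, isUnit_one_add_adjoint (hunit u), rfl⟩, ?_, ?_⟩
  · exact hgrad
  · intro u hu
    have h0 := IsLocalExtr.hasGradientAt_eq_zero hu (hgrad u)
    exact ⟨h0, add_sub_eq_of_gradient_eq_zero h0⟩
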